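/- Let $n\ge 1$. A Wajsberg algebra is an algebra $\langle A,\to,\neg,1\rangle$ satisfying $1\to x=x$, $(x\to y)\to((y\to z)\to(x\to z))=1$, $(x\to y)\to y=(y\to x)\to x$ and $(\neg y\to\neg x)\to(x\to y)=1$; Wajsberg algebras are MV-algebras presented with $\to$ instead of $\oplus$. Put $x\vee y=(x\to y)\to y$, $x\odot y=\neg(x\to\neg y)$, and let $B(A)=\{x\in A: x\odot x=x\}$, a Boolean algebra. The interval $[0,1]$ is a Wajsberg algebra with $x\to y=\min\{1,1-x+y\}$ and $\neg x=1-x$, and $L_{d+1}=\{0,\frac1d,\dots,1\}$ is a subalgebra of it for $d\ge 1$. An algebra is $(n+1)$-valued if it lies in the variety generated by $L_{n+1}$. For $1\le i\le n$, $\sigma_i$ is the unary term operation with $\sigma_i(\frac jn)=1$ if $i+j>n$ and $\sigma_i(\frac jn)=0$ otherwise on $L_{n+1}$; on an arbitrary Wajsberg algebra, $\sigma_i$ is computed by the fixed term $\ell_{n,n-i}$, where $\ell_{0,b}(x)=1$ if $b<0$ and $0$ otherwise, and $\ell_{a+1,b}(x)=(\ell_{a,b}(x)\oplus x)\odot\ell_{a,b-1}(x)$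 with $x\oplus y=\neg x\to y$ and $0=\neg 1$. A set $F\ni 1$ is an implicative filter of $A$ if $a,a\to b\in F$ implies $b\in F$; it is prime if it is a prime filter of the lattice $A$. Write $A/P\subseteq L_{d+1}$ if $A/P$ is isomorphic to a subalgebra of $L_{d+1}$. For a positive divisor $d$ of $n$ let $h_A(d)=B(A)\cap\bigcap\{P: P\text{ a prime implicative filter of }A,\ A/P\subseteq L_{d+1}\}$, a filter of $B(A)$. For a Boolean algebra $B$ and a map $h$ from the positive divisors of $n$ to the filters of $B$ (the improper filter is allowed), $\langle B,h\rangle\in B^{n+1}$ means that $h(n)=\{1\}$ and $h(\gcd(d,r))=h(d)\vee h(r)$ in the lattice of filters. Two such pairs are isomorphic if there is a Boolean isomorphism $\varphi:B_1\to B_2$ with $\varphi^{-1}(h_2(d))=h_1(d)$ for all $d$. $B^{[n]}$ is the Wajsberg algebra of the monotone functions $f:\{1,\dots,n\}\to B$ with $(f\to g)(k)=\bigwedge_{i=1}^{n-k+1}(f(i)\to g(i+k-1))$, $(\neg f)(k)=\neg f(n+1-k)$ and the constant function $1$. $M(B,h)$ is its subalgebra of those $f$ with $f(q\frac nd)\to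 f((q-1)\frac nd+1)\in h(d)$ for all $d\mid n$ and $1\le q\le d$. An $(n+1)$-valued Boolean space is a pair $\langle X,h\rangle$ of a compact Hausdorff totally disconnected space $X$ and a map $h$ from the positive divisors of $n$ to the closed subsets of $X$ with $h(\gcd(d,r))=h(d)\cap h(r)$ and $h(n)=X$. $\langle X,h\rangle$ and $\langle Y,g\rangle$ are isomorphic if there is a homeomorphism $\varphi:X\to Y$ with $\varphi^{-1}(g(d))=h(d)$ for all $d$. $C(X,h)$ is the algebra, with pointwise operations, of the continuous functions $f:X\to L_{n+1}$ with $f(h(d))\subseteq L_{d+1}$ for all $d\mid n$. $\langle X,h\rangle$ represents $A$ if it is an $(n+1)$-valued Boolean space and $A\cong C(X,h)$. The Stone space $\chi(B)$ is the set of prime filters of $B$ with the topology with basis $s(a)=\{U: a\in U\}$, $a\in B$, and $\delta(F)=\bigcap\{s(x):x\in F\}$ for a filter $F$ of $B$. For a Wajsberg algebra $A$ consider two statements. (I) $x\mapsto(\sigma_1(x),\dots,\sigma_n(x))$ is an isomorphism from $A$ onto $M(B(A),h_A)$. (II) There is an $(n+1)$-valued Boolean space that represents $A$, any two that represent $A$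 are isomorphic, and the underlying space of each is homeomorphic to $\chi(B(A))$. Then the following hold. 1. For every Wajsberg algebra $A$, (I) and (II) are equivalent. 2. If $A$ is $(n+1)$-valued, then both (I) and (II) hold; moreover $\langle B(A),h_A\rangle\in B^{n+1}$ and $\langle\chi(B(A)),\delta\circ h_A\rangle$ represents $A$. 3. Let $\langle B,h\rangle\in B^{n+1}$. Then $\langle B,h\rangle$ is isomorphic to $\langle B(A),h_A\rangle$ for $A=M(B,h)$, and consequently for every Wajsberg algebra $A$ isomorphic to $C(\chi(B),\delta\circ h)$. 4. For every Boolean algebra $B$, $\delta$ is an order-antiisomorphism from the filters of $B$ onto the closed subsets of $\chi(B)$. 5. Let $\langle B,h\rangle\in B^{n+1}$ (for instance $B=B(A)$). Then $\langle\chi(B),\delta\circ h\rangle$ is an $(n+1)$-valued Boolean space, and the map $\Psi:M(B,h)\to C(\chi(B),\delta\circ h)$, $\Psi(g)=\widetilde g$, is a well-defined isomorphism of Wajsberg algebras, where, with $S_i=s(g(i))$, $\widetilde g(U)=1$ if $U\in S_1$, $\widetilde g(U)=\frac kn$ if $U\in S_{n-k+1}\setminus S_{n-k}$ for $1\le k\le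 n-1$, and $\widetilde g(U)=0$ if $U\notin S_n$. -/

import Mathlib

open Order

universe u v w

/-! ### Wajsberg algebras -/

/-- Wajsberg algebras `⟨A, →, ¬, 1⟩`. -/
class WajsbergAlgebra (A : Type*) where
  imp : A → A → A
  neg : A → A
  one : A
  one_imp : ∀ x, imp one x = x
  imp_trans : ∀ x y z, imp (imp x y) (imp (imp y z) (imp x z)) = one
  imp_imp_comm : ∀ x y, imp (imp x y) y = imp (imp y x) x
  contra : ∀ x y, imp (imp (neg y) (neg x)) (imp x y) = one

namespace WajsbergAlgebra

infixr:60 "⇝" => WajsbergAlgebra.imp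
prefix:max "∼" => WajsbergAlgebra.neg

section Basic

variable {A : Type*} [WajsbergAlgebra A]

/-- `0 = ¬1`. -/
def zero : A := ∼(one : A)

/-- `x ∨ y = (x → y) → y`. -/
def vee (x y : A) : A := (x ⇝ y) ⇝ y

/-- `x ∧ y = ¬(¬x ∨ ¬y)`. -/
def wedge (x y : A) : A := ∼(vee ∼x ∼y)

/-- `x ⊕ y = ¬x → y`. -/
def oplus (x y : A) : A := ∼x ⇝ y

/-- `x ⊙ y = ¬(x → ¬y)`. -/
def odot (x y : A) : A := ∼(x ⇝ ∼y)

/-- The order: `x ≤ y` if and only if `x → y = 1`. -/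
def Le (x y : A) : Prop := x ⇝ y = one

theorem le_rfl' (x : A) : Le x x := by
  have h := imp_trans (one : A) one x
  simpa [one_imp, Le] using h

theorem Le.antisymm {x y : A} (h : Le x y) (h' : Le y x) : x = y := by
  have e := imp_imp_comm x y
  unfold Le at h h'
  rw [h, h', one_imp, one_imp] at e
  exact e.symm

theorem one_le {x : A} (h : Le one x) : x = one := by
  unfold Le at h
  rwa [one_imp] at h

theorem Le.trans {x y z : A} (h : Le x y) (h' : Le y z) : Le x z := by
  have e := imp_trans x y z
  unfold Le at *
  rwa [h, h', one_imp, one_imp] at e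

theorem imp_antitone {x y : A} (z : A) (h : Le x y) : Le (y ⇝ z) (x ⇝ z) := by
  have e := imp_trans x y z
  unfold Le at *
  rwa [h, one_imp] at e

theorem le_one (x : A) : Le x one := by
  have h1 : (x ⇝ one) ⇝ one = (one : A) := by
    rw [imp_imp_comm, one_imp]; exact le_rfl' x
  have h2 := imp_trans (one : A) x one
  rw [one_imp, one_imp, h1] at h2
  exact h2

theorem le_imp (x y : A) : Le x (y ⇝ x) := by
  have h := imp_trans y one x
  rw [show y ⇝ one = (one : A) from le_one y, one_imp, one_imp] at h
  exact h

theorem le_vee_right (x y : A) : Le y (vee x y) := le_imp _ _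

theorem vee_comm (x y : A) : vee x y = vee y x := imp_imp_comm x y

theorem le_vee_left (x y : A) : Le x (vee x y) := by
  rw [vee_comm]; exact le_vee_right y x

theorem exch_le (x y z : A) : Le (x ⇝ y ⇝ z) (y ⇝ x ⇝ z) :=
  Le.trans (imp_trans x (y ⇝ z) z) (imp_antitone _ (le_vee_left y z))

theorem exch (x y z : A) : x ⇝ y ⇝ z = y ⇝ x ⇝ z :=
  (exch_le x y z).antisymm (exch_le y x z)

theorem imp_trans' (x y z : A) : Le (y ⇝ z) ((x ⇝ y) ⇝ (x ⇝ z)) := by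
  have h := imp_trans x y z
  unfold Le
  rwa [exch] at h

theorem imp_mono {y z : A} (x : A) (h : Le y z) : Le (x ⇝ y) (x ⇝ z) := by
  have e := imp_trans' x y z
  unfold Le at *
  rwa [h, one_imp] at e

theorem neg_neg_le (x : A) : Le ∼∼x x := by
  have h1 : Le ∼∼x (∼∼(one : A) ⇝ ∼∼x) := le_imp _ _
  have h2 : Le (∼∼(one : A) ⇝ ∼∼x) (∼x ⇝ ∼(one : A)) := contra _ _
  have h3 : Le (∼x ⇝ ∼(one : A)) (one ⇝ x) := contra _ _
  rw [one_imp] at h3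
  exact h1.trans (h2.trans h3)

theorem neg_neg' (x : A) : ∼∼x = x := by
  refine (neg_neg_le x).antisymm ?_
  have h := contra x (∼∼x)
  rw [show ∼∼(∼x) ⇝ ∼x = (one : A) from neg_neg_le ∼x, one_imp] at h
  exact h

theorem neg_imp_neg (x y : A) : ∼y ⇝ ∼x = x ⇝ y := by
  refine Le.antisymm (contra x y) ?_
  have h := contra ∼y ∼x
  rwa [neg_neg', neg_neg'] at h

theorem neg_antitone {x y : A} (h : Le x y) : Le ∼y ∼x := by
  unfold Le; rw [neg_imp_neg]; exact h

theorem imp_zero (x : A) : x ⇝ zero = ∼x := by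
  unfold zero
  rw [← neg_imp_neg, neg_neg', one_imp]

theorem zero_le' (x : A) : Le zero x := by
  unfold Le zero
  rw [← neg_imp_neg, neg_neg']
  exact le_one _

theorem vee_le {x y z : A} (h : Le x z) (h' : Le y z) : Le (vee x y) z := by
  have h1 : Le (vee x y) (vee z y) := imp_antitone _ (imp_antitone _ h)
  rw [vee_comm z y] at h1
  unfold vee at h1
  unfold Le at h'
  rw [h', one_imp] at h1
  exact h1

theorem wedge_le_left (x y : A) : Le (wedge x y) x := by
  have := neg_antitone (le_vee_left ∼x ∼y)
  rwa [neg_neg'] at this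

theorem wedge_le_right (x y : A) : Le (wedge x y) y := by
  have := neg_antitone (le_vee_right ∼x ∼y)
  rwa [neg_neg'] at this

theorem le_wedge {x y z : A} (h : Le z x) (h' : Le z y) : Le z (wedge x y) := by
  have := neg_antitone (vee_le (neg_antitone h) (neg_antitone h'))
  rwa [neg_neg'] at this

theorem imp_neg_comm (x y : A) : x ⇝ ∼y = y ⇝ ∼x := by
  rw [← neg_imp_neg, neg_neg']

theorem odot_comm (x y : A) : odot x y = odot y x := by
  unfold odot; rw [imp_neg_comm]

theorem odot_imp (x y z : A) : odot x y ⇝ z = x ⇝ y ⇝ z := by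
  unfold odot
  rw [← neg_imp_neg, neg_neg', exch, neg_imp_neg]

theorem odot_assoc (x y z : A) : odot (odot x y) z = odot x (odot y z) := by
  have key : ∀ w : A, odot (odot x y) z ⇝ w = odot x (odot y z) ⇝ w := by
    intro w; simp only [odot_imp]
  refine Le.antisymm ?_ ?_
  · unfold Le; rw [key]; exact le_rfl' _
  · unfold Le; rw [← key]; exact le_rfl' _

theorem odot_le_left (x y : A) : Le (odot x y) x := by
  unfold Le; rw [odot_imp, exch, show x ⇝ x = (one : A) from le_rfl' x]; exact le_one y

theorem odot_le_right (x y : A) : Le (odot x y) y := by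
  rw [odot_comm]; exact odot_le_left y x

/-- Divisibility: `x ⊙ (x → z) = x ∧ z`. -/
theorem odot_imp_self (x z : A) : odot x (x ⇝ z) = wedge x z := by
  rw [odot_comm]
  unfold odot wedge
  rw [vee_comm, ← neg_imp_neg x z]
  rfl

theorem one_odot_one : odot (one : A) one = one := by
  unfold odot; rw [one_imp, neg_neg']

theorem neg_idem {x : A} (h : odot x x = x) : odot ∼x ∼x = ∼x := by
  have h1 : x ⇝ ∼x = ∼x := by
    rw [← neg_neg' (x ⇝ ∼x)]; exact congrArg neg h
  have h2 := imp_imp_comm x ∼x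
  rw [h1, show ∼x ⇝ ∼x = (one : A) from le_rfl' _] at h2
  have h3 : ∼x ⇝ x = x := Le.antisymm h2.symm (le_imp _ _)
  unfold odot
  rw [neg_neg', h3]

theorem odot_idem {x y : A} (hx : odot x x = x) (hy : odot y y = y) :
    odot (odot x y) (odot x y) = odot x y := by
  rw [odot_assoc, ← odot_assoc y x y, odot_comm y x, odot_assoc x y y, hy, ← odot_assoc, hx]

theorem wedge_eq_odot {x : A} (hx : odot x x = x) (y : A) : wedge x y = odot x y := by
  refine Le.antisymm ?_ (le_wedge (odot_le_left _ _) (odot_le_right _ _))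
  have h1 : odot x (wedge x y) = wedge x y := by
    rw [← odot_imp_self, ← odot_assoc, hx]
  rw [← h1]
  unfold odot
  exact neg_antitone (imp_mono _ (neg_antitone (wedge_le_right x y)))

theorem wedge_idem {x y : A} (hx : odot x x = x) (hy : odot y y = y) :
    odot (wedge x y) (wedge x y) = wedge x y := by
  rw [wedge_eq_odot hx]; exact odot_idem hx hy

theorem imp_idem {x y : A} (hx : odot x x = x) (hy : odot y y = y) :
    odot (x ⇝ y) (x ⇝ y) = x ⇝ y := by
  have : x ⇝ y = ∼(odot x ∼y) := by unfold odot; rw [neg_neg', neg_neg']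
  rw [this]
  exact neg_idem (odot_idem hx (neg_idem hy))

theorem vee_idem {x y : A} (hx : odot x x = x) (hy : odot y y = y) :
    odot (vee x y) (vee x y) = vee x y :=
  imp_idem (imp_idem hx hy) hy

end Basic

/-! ### The Boolean algebra of idempotents -/

/-- `B(A) = {x : x ⊙ x = x}`. -/
def BooleanPart (A : Type*) [WajsbergAlgebra A] : Type _ := {x : A // odot x x = x}

namespace BooleanPart

variable {A : Type*} [WajsbergAlgebra A]

/-- `B(A)` as a lattice, with the order and the operations of `A`. -/
instance : Lattice (BooleanPart A) where
  le x y := Le x.1 y.1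
  le_refl x := le_rfl' x.1
  le_trans _ _ _ h h' := Le.trans h h'
  le_antisymm _ _ h h' := Subtype.ext (Le.antisymm h h')
  sup x y := ⟨vee x.1 y.1, vee_idem x.2 y.2⟩
  inf x y := ⟨wedge x.1 y.1, wedge_idem x.2 y.2⟩
  le_sup_left _ _ := le_vee_left _ _
  le_sup_right _ _ := le_vee_right _ _
  sup_le _ _ _ h h' := vee_le h h'
  inf_le_left _ _ := wedge_le_left _ _
  inf_le_right _ _ := wedge_le_right _ _
  le_inf _ _ _ h h' := le_wedge h h'

/-- The Heyting algebra structure of `B(A)`, with the operations `→`, `¬`, `1` and `0` of `A`. -/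
instance instHeyting : HeytingAlgebra (BooleanPart A) where
  top := ⟨one, one_odot_one⟩
  le_top x := le_one x.1
  bot := ⟨zero, neg_idem one_odot_one⟩
  bot_le x := zero_le' x.1
  himp x y := ⟨x.1 ⇝ y.1, imp_idem x.2 y.2⟩
  compl x := ⟨∼x.1, neg_idem x.2⟩
  le_himp_iff x y z := by
    change x.1 ⇝ y.1 ⇝ z.1 = one ↔ wedge x.1 y.1 ⇝ z.1 = one
    rw [wedge_eq_odot x.2, odot_imp]
  himp_bot x := Subtype.ext (imp_zero x.1)

/-- `B(A)` is a Boolean algebra, with the operations of `A`. -/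
instance : BooleanAlgebra (BooleanPart A) :=
  BooleanAlgebra.ofRegular fun x => Subtype.ext (neg_neg' (x ⊔ xᶜ).1)

end BooleanPart

/-! ### Homomorphisms, subalgebras, products, implicative filters and quotients -/

/-- Homomorphisms of Wajsberg algebras. -/
structure Hom (A A' : Type*) [WajsbergAlgebra A] [WajsbergAlgebra A'] where
  toFun : A → A'
  map_imp : ∀ x y, toFun (x ⇝ y) = toFun x ⇝ toFun y
  map_neg : ∀ x, toFun ∼x = ∼(toFun x)
  map_one : toFun one = one

/-- Isomorphisms of Wajsberg algebras. -/
structure Iso (A A' : Type*) [WajsbergAlgebra A] [WajsbergAlgebra A'] extends A ≃ A' where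
  map_imp : ∀ x y, toFun (x ⇝ y) = toFun x ⇝ toFun y
  map_neg : ∀ x, toFun ∼x = ∼(toFun x)
  map_one : toFun one = one

/-- Subalgebras of a Wajsberg algebra. -/
structure Subalg (A : Type*) [WajsbergAlgebra A] where
  carrier : Set A
  imp_mem : ∀ {x y}, x ∈ carrier → y ∈ carrier → x ⇝ y ∈ carrier
  neg_mem : ∀ {x}, x ∈ carrier → ∼x ∈ carrier
  one_mem : one ∈ carrier

/-- The underlying type of a subalgebra. -/
def Subalg.Elem {A : Type*} [WajsbergAlgebra A] (S : Subalg A) : Type _ := {x : A // x ∈ S.carrier}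

instance {A : Type*} [WajsbergAlgebra A] (S : Subalg A) : WajsbergAlgebra S.Elem where
  imp x y := ⟨x.1 ⇝ y.1, S.imp_mem x.2 y.2⟩
  neg x := ⟨∼x.1, S.neg_mem x.2⟩
  one := ⟨one, S.one_mem⟩
  one_imp _ := Subtype.ext (one_imp _)
  imp_trans _ _ _ := Subtype.ext (imp_trans _ _ _)
  imp_imp_comm _ _ := Subtype.ext (imp_imp_comm _ _)
  contra _ _ := Subtype.ext (contra _ _)

/-- Functions with values in a Wajsberg algebra, with the pointwise operations. -/
instance {X A : Type*} [WajsbergAlgebra A] : WajsbergAlgebra (X → A) where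
  imp f g x := f x ⇝ g x
  neg f x := ∼(f x)
  one _ := one
  one_imp _ := funext fun _ => one_imp _
  imp_trans _ _ _ := funext fun _ => imp_trans _ _ _
  imp_imp_comm _ _ := funext fun _ => imp_imp_comm _ _
  contra _ _ := funext fun _ => contra _ _

/-- Implicative filters. -/
structure ImplFilter (A : Type*) [WajsbergAlgebra A] where
  carrier : Set A
  one_mem : one ∈ carrier
  mp : ∀ {a b}, a ∈ carrier → a ⇝ b ∈ carrier → b ∈ carrier

namespace ImplFilter

variable {A : Type*} [WajsbergAlgebra A] (F : ImplFilter A)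

/-- An implicative filter is prime if it is a prime filter of the lattice `A`. -/
def IsPrime : Prop :=
  F.carrier ≠ Set.univ ∧ ∀ x y, vee x y ∈ F.carrier → x ∈ F.carrier ∨ y ∈ F.carrier

variable {F} in
theorem mem_of_le {x y : A} (h : Le x y) (hx : x ∈ F.carrier) : y ∈ F.carrier :=
  F.mp hx (by unfold Le at h; rw [h]; exact F.one_mem)

/-- The congruence of an implicative filter. -/
def con : Setoid A where
  r x y := x ⇝ y ∈ F.carrier ∧ y ⇝ x ∈ F.carrier
  iseqv :=
    { refl := fun x => by
        rw [show x ⇝ x = (one : A) from le_rfl' x]; exact ⟨F.one_mem, F.one_mem⟩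
      symm := fun h => ⟨h.2, h.1⟩
      trans := fun {x y z} h h' =>
        ⟨F.mp h'.1 (mem_of_le (imp_trans x y z) h.1), F.mp h.2 (mem_of_le (imp_trans z y x) h'.2)⟩ }

theorem con_imp {x x' y y' : A} (hx : F.con x x') (hy : F.con y y') :
    F.con (x ⇝ y) (x' ⇝ y') := by
  have h1 : F.con (x ⇝ y) (x' ⇝ y) :=
    ⟨mem_of_le (imp_trans x' x y) hx.2, mem_of_le (imp_trans x x' y) hx.1⟩
  have h2 : F.con (x' ⇝ y) (x' ⇝ y') :=
    ⟨mem_of_le (imp_trans' x' y y') hy.1, mem_of_le (imp_trans' x' y' y) hy.2⟩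
  exact F.con.iseqv.trans h1 h2

/-- The quotient `A/F`. -/
def Quot : Type _ := Quotient F.con

instance : WajsbergAlgebra F.Quot where
  imp := Quotient.map₂ imp fun _ _ hx _ _ hy => F.con_imp hx hy
  neg := Quotient.map neg fun x x' hx =>
    ⟨by rw [neg_imp_neg]; exact hx.2, by rw [neg_imp_neg]; exact hx.1⟩
  one := Quotient.mk _ one
  one_imp := by rintro ⟨x⟩; exact congrArg (Quotient.mk _) (one_imp x)
  imp_trans := by rintro ⟨x⟩ ⟨y⟩ ⟨z⟩; exact congrArg (Quotient.mk _) (imp_trans x y z)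
  imp_imp_comm := by rintro ⟨x⟩ ⟨y⟩; exact congrArg (Quotient.mk _) (imp_imp_comm x y)
  contra := by rintro ⟨x⟩ ⟨y⟩; exact congrArg (Quotient.mk _) (contra x y)

end ImplFilter

/-! ### The algebra `[0,1]`, its subalgebras `L_{d+1}`, and `(n+1)`-valued algebras -/

/-- `[0,1]` with `x → y = min {1, 1 - x + y}` and `¬x = 1 - x`. -/
noncomputable instance : WajsbergAlgebra unitInterval where
  imp x y := ⟨min 1 (1 - x.1 + y.1), le_min zero_le_one (by linarith [x.2.2, y.2.1]),
    min_le_left _ _⟩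
  neg x := ⟨1 - x.1, by linarith [x.2.2], by linarith [x.2.1]⟩
  one := ⟨1, zero_le_one, le_rfl⟩
  one_imp x := Subtype.ext (by simpa using x.2.2)
  imp_trans x y z := Subtype.ext (by
    obtain ⟨⟨x, _, _⟩, ⟨y, _, _⟩, ⟨z, _, _⟩⟩ := x, y, z
    simp only [min_def]; split_ifs <;> linarith)
  imp_imp_comm x y := Subtype.ext (by
    obtain ⟨⟨x, _, _⟩, ⟨y, _, _⟩⟩ := x, y
    simp only [min_def]; split_ifs <;> linarith)
  contra x y := Subtype.ext (by
    obtain ⟨⟨x, _, _⟩, ⟨y, _, _⟩⟩ := x, y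
    simp only [min_def]; split_ifs <;> linarith)

/-- `L_{d+1} = {0, 1/d, 2/d, …, 1}`, the universe of a subalgebra of `[0,1]` when `d ≥ 1`. -/
def Luk (d : ℕ) : Set unitInterval := {x | ∃ k : ℕ, k ≤ d ∧ (x : ℝ) = k / d}

theorem one_mem_Luk {d : ℕ} (hd : 0 < d) : one ∈ Luk d :=
  ⟨d, le_rfl, (div_self (by positivity)).symm⟩

theorem neg_mem_Luk {d : ℕ} (hd : 0 < d) {x : unitInterval} (hx : x ∈ Luk d) : ∼x ∈ Luk d := by
  obtain ⟨k, hk, e⟩ := hx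
  refine ⟨d - k, by omega, ?_⟩
  change 1 - (x : ℝ) = _
  rw [e, Nat.cast_sub hk]
  field_simp

theorem imp_mem_Luk {d : ℕ} (hd : 0 < d) {x y : unitInterval} (hx : x ∈ Luk d) (hy : y ∈ Luk d) :
    x ⇝ y ∈ Luk d := by
  obtain ⟨k, hk, e⟩ := hx
  obtain ⟨l, hl, e'⟩ := hy
  have hd' : (0 : ℝ) < d := by exact_mod_cast hd
  refine ⟨min d (d - k + l), min_le_left _ _, ?_⟩
  change min 1 (1 - (x : ℝ) + y) = _
  rw [e, e', Nat.cast_min, ← min_div_div_right hd'.le]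
  push_cast [Nat.cast_sub hk]
  congr 1 <;> field_simp

/-- `A` is isomorphic to a subalgebra of `L_{d+1}` (written `A ⊆ L_{d+1}`). -/
def EmbedsInLuk (A : Type*) [WajsbergAlgebra A] (d : ℕ) : Prop :=
  ∃ g : Hom A unitInterval, Function.Injective g.toFun ∧ ∀ x, g.toFun x ∈ Luk d

/-- Terms in the language of Wajsberg algebras. -/
inductive Term : Type
  | var : ℕ → Term
  | imp : Term → Term → Term
  | neg : Term → Term
  | one : Term

/-- The value of a term under an assignment of the variables. -/
def Term.eval {A : Type*} [WajsbergAlgebra A] (v : ℕ → A) : Term → A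
  | .var i => v i
  | .imp s t => s.eval v ⇝ t.eval v
  | .neg t => ∼(t.eval v)
  | .one => WajsbergAlgebra.one

/-- `A` is an `(n+1)`-valued Wajsberg algebra: it belongs to the variety generated by `L_{n+1}`,
that is, it satisfies all the identities that hold in `L_{n+1}`. -/
def IsValued (n : ℕ) (A : Type*) [WajsbergAlgebra A] : Prop :=
  ∀ s t : Term,
    (∀ v : ℕ → unitInterval, (∀ i, v i ∈ Luk n) → s.eval v = t.eval v) →
      ∀ v : ℕ → A, s.eval v = t.eval v

/-! ### The operators `σ_i` -/

/-- A unary term operation which on `[0,1]` is the truncation to `[0,1]` of `a x - b`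
(see `lin_unitInterval`). -/
def lin {A : Type*} [WajsbergAlgebra A] : ℕ → ℤ → A → A
  | 0, b, _ => if b < 0 then one else zero
  | a + 1, b, x => odot (oplus (lin a b x) x) (lin a (b - 1) x)

/-- The operators `σ_i`, `1 ≤ i ≤ n`: the unary term operation that takes the values
`σ_i (j/n) = 1` if `i + j > n` and `σ_i (j/n) = 0` otherwise on `L_{n+1}` (see `sigma_Luk`). -/
def sigma {A : Type*} [WajsbergAlgebra A] (n i : ℕ) (x : A) : A := lin n (n - i) x

theorem lin_unitInterval (a : ℕ) (b : ℤ) (x : unitInterval) :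
    ((lin a b x : unitInterval) : ℝ) = max 0 (min 1 (a * (x : ℝ) - b)) := by
  induction a generalizing b with
  | zero =>
    unfold lin
    split_ifs with h
    · have : (b : ℝ) ≤ -1 := by exact_mod_cast (by omega : b ≤ -1)
      change (1 : ℝ) = _
      rw [min_eq_left (by push_cast; linarith)]; simp
    · have : (0 : ℝ) ≤ b := by exact_mod_cast (by omega : 0 ≤ b)
      change (1 : ℝ) - 1 = _
      rw [max_eq_left]
      · simp
      · exact (min_le_right _ _).trans (by push_cast; linarith)
  | succ a ih =>
    unfold lin
    change 1 - min 1 (1 - min 1 (1 - (1 - ((lin a b x : unitInterval) : ℝ)) + x) + (1 - ((lin a (b - 1) x : unitInterval) : ℝ))) = _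
    rw [ih, ih]
    push_cast
    have h0 := x.2.1
    have h1 := x.2.2
    generalize (x : ℝ) = y at *
    have e : ((a : ℝ) + 1) * y - b = (a * y - b) + y := by ring
    have e' : (a : ℝ) * y - (b - 1) = (a * y - b) + 1 := by ring
    rw [e, e']
    generalize (a : ℝ) * y - b = t
    simp only [min_def, max_def]
    split_ifs <;> linarith

theorem sigma_Luk {n i j : ℕ} (hn : 0 < n) (x : unitInterval) (hx : (x : ℝ) = j / n) :
    ((sigma n i x : unitInterval) : ℝ) = if n < i + j then 1 else 0 := by
  unfold sigma
  rw [lin_unitInterval, hx, mul_div_cancel₀ _ (by positivity : (n : ℝ) ≠ 0)]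
  push_cast
  split_ifs with h
  · have : (n : ℝ) + 1 ≤ i + j := by exact_mod_cast h
    rw [min_eq_left (by linarith)]; simp
  · have : (i : ℝ) + j ≤ n := by exact_mod_cast not_lt.1 h
    rw [max_eq_left]
    exact (min_le_right _ _).trans (by linarith)

/-! ### The algebra `B^{[n]}` -/

/-- The index set `{1, 2, …, n}`. -/
abbrev Idx (n : ℕ) : Type := {i : ℕ // 1 ≤ i ∧ i ≤ n}

/-- `B^{[n]}`: the monotone functions from `{1, …, n}` into `B`. -/
abbrev Pow (n : ℕ) (B : Type*) [BooleanAlgebra B] : Type _ := Idx n →o B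

section Pow

variable {n : ℕ} {B : Type*} [BooleanAlgebra B]

/-- `(f → g)(k) = ⋀_{i=1}^{n-k+1} (f(i) → g(i+k-1))`. -/
def powImpFun (f g : Idx n → B) (k : Idx n) : B :=
  (Finset.Icc 1 (n - k.1 + 1)).attach.inf fun i =>
    have hi := Finset.mem_Icc.1 i.2
    have hk := k.2
    f ⟨i.1, by omega⟩ ⇨ g ⟨i.1 + k.1 - 1, by omega⟩

/-- `(¬f)(k) = ¬f(n+1-k)`. -/
def powNegFun (f : Idx n → B) (k : Idx n) : B := (f ⟨n + 1 - k.1, by have := k.2; omega⟩)ᶜ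

theorem le_powImpFun {f g : Idx n → B} {k : Idx n} {b : B} :
    b ≤ powImpFun f g k ↔ ∀ i j : Idx n, j.1 + 1 = i.1 + k.1 → b ≤ f i ⇨ g j := by
  unfold powImpFun
  rw [Finset.le_inf_iff]
  constructor
  · rintro h ⟨i, hi⟩ ⟨j, hj⟩ e
    dsimp only at e
    have hk := k.2
    have := h ⟨i, Finset.mem_Icc.2 (by omega)⟩ (Finset.mem_attach _ _)
    simpa only [show i + k.1 - 1 = j by omega] using this
  · rintro h ⟨i, hi⟩ -
    have hi' := Finset.mem_Icc.1 hi
    have hk := k.2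
    exact h _ _ (by dsimp only; omega)

theorem powImpFun_mono (f : Idx n → B) (g : Idx n →o B) : Monotone (powImpFun f g) := by
  intro k l hkl
  rw [le_powImpFun]
  intro i j e
  have hkl' : k.1 ≤ l.1 := hkl
  have hi := i.2
  have hj := j.2
  have hk := k.2
  refine (le_powImpFun.1 le_rfl i ⟨i.1 + k.1 - 1, by omega⟩ (by dsimp only; omega)).trans ?_
  exact himp_le_himp_left (g.monotone (by change i.1 + k.1 - 1 ≤ j.1; omega))

/-- The implication of `B^{[n]}`. -/
def powImp (f g : Pow n B) : Pow n B := ⟨powImpFun f g, powImpFun_mono f g⟩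

/-- The negation of `B^{[n]}`. -/
def powNeg (f : Pow n B) : Pow n B :=
  ⟨powNegFun f, fun k l h => compl_le_compl (f.monotone (by
    change n + 1 - l.1 ≤ n + 1 - k.1
    have h' : k.1 ≤ l.1 := h
    omega))⟩

/-- The constant function `1`. -/
def powOne : Pow n B := ⟨fun _ => ⊤, fun _ _ _ => le_rfl⟩

/-- A Boolean homomorphism from `B` into the truth values. -/
structure IsPt (p : B → Prop) : Prop where
  inf : ∀ a b, p (a ⊓ b) ↔ p a ∧ p b
  compl : ∀ a, p aᶜ ↔ ¬p a
  top : p ⊤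

theorem IsPt.mono {p : B → Prop} (hp : IsPt p) {a b : B} (h : a ≤ b) (ha : p a) : p b := by
  rw [← inf_eq_left.2 h, hp.inf] at ha
  exact ha.2

theorem IsPt.himp {p : B → Prop} (hp : IsPt p) (a b : B) : p (a ⇨ b) ↔ (p a → p b) := by
  have : a ⇨ b = (a ⊓ bᶜ)ᶜ := by rw [compl_inf, compl_compl, himp_eq, sup_comm]
  rw [this, hp.compl, hp.inf, hp.compl]
  tauto

theorem exists_pt {a b : B} (h : ¬a ≤ b) : ∃ p : B → Prop, IsPt p ∧ p a ∧ ¬p b := by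
  have hd : Disjoint (PFilter.principal a : Set B) (Ideal.principal b : Set B) := by
    rw [Set.disjoint_left]
    intro x hx hx'
    exact h (le_trans (PFilter.mem_principal.1 hx) (Ideal.mem_principal.1 hx'))
  obtain ⟨J, hJ, hI, hF⟩ := DistribLattice.prime_ideal_of_disjoint_filter_ideal hd
  refine ⟨fun x => x ∉ J, ⟨fun x y => ?_, fun x => ?_, fun ht => ?_⟩, ?_, ?_⟩
  · constructor
    · exact fun hxy => ⟨fun hx => hxy (J.lower inf_le_left hx), fun hy => hxy (J.lower inf_le_right hy)⟩
    · rintro ⟨hx, hy⟩ hxy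
      exact (hJ.mem_or_mem hxy).elim hx hy
  · constructor
    · intro hx
      rw [not_not]
      exact hJ.mem_or_compl_mem.resolve_right hx
    · intro hx hx'
      rw [not_not] at hx
      exact hJ.1.top_notMem (by
        have := Order.Ideal.sup_mem hx hx'; rwa [sup_compl_eq_top] at this)
  · exact hJ.1.top_notMem ht
  · exact Set.disjoint_left.1 hF (PFilter.mem_principal.2 le_rfl)
  · exact fun hb => hb (hI (Ideal.mem_principal.2 le_rfl))

theorem IsPt.powImpFun {p : B → Prop} (hp : IsPt p) (f g : Idx n → B) (k : Idx n) :
    p (powImpFun f g k) ↔ ∀ i j : Idx n, j.1 + 1 = i.1 + k.1 → p (f i) → p (g j) := by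
  have hinf : ∀ {ι : Type} (s : Finset ι) (u : ι → B), p (s.inf u) ↔ ∀ i ∈ s, p (u i) := by
    intro ι s u
    classical
    induction s using Finset.induction_on with
    | empty => simp [hp.top]
    | insert a s ha ih => rw [Finset.inf_insert, hp.inf, ih]; simp
  constructor
  · intro h i j e hi
    have := hp.mono (le_powImpFun.1 le_rfl i j e) h
    exact (hp.himp _ _).1 this hi
  · intro h
    unfold WajsbergAlgebra.powImpFun
    rw [hinf]
    rintro ⟨i, hi⟩ -
    have hi' := Finset.mem_Icc.1 hi
    have hk := k.2
    rw [hp.himp]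
    exact h _ _ (by dsimp only; omega)

/-- Under a Boolean homomorphism into the truth values, a monotone function is a threshold. -/
def IsCut (p : B → Prop) (f : Pow n B) (v : ℕ) : Prop := v ≤ n ∧ ∀ i : Idx n, p (f i) ↔ v < i.1

theorem IsPt.exists_cut {p : B → Prop} (hp : IsPt p) (f : Pow n B) : ∃ v, IsCut p f v := by
  classical
  have hex : ∃ v, v = n ∨ ∃ h : v < n, p (f ⟨v + 1, by omega⟩) := ⟨n, Or.inl rfl⟩
  have hle : Nat.find hex ≤ n := Nat.find_le (Or.inl rfl)
  refine ⟨Nat.find hex, hle, fun i => ⟨fun hi => ?_, fun hi => ?_⟩⟩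
  · have := i.2
    have h1 : Nat.find hex ≤ i.1 - 1 := by
      refine Nat.find_le (Or.inr ⟨by omega, ?_⟩)
      have : (⟨i.1 - 1 + 1, by omega⟩ : Idx n) = i := Subtype.ext (by dsimp only; omega)
      rwa [this]
    omega
  · have := i.2
    rcases Nat.find_spec hex with h | ⟨h, h'⟩
    · omega
    · exact hp.mono (f.monotone (show Nat.find hex + 1 ≤ i.1 by omega)) h'

theorem IsPt.cut_imp {p : B → Prop} (hp : IsPt p) {f g : Pow n B} {v w : ℕ} (hf : IsCut p f v)
    (hg : IsCut p g w) : IsCut p (powImp f g) (w - v) := by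
  obtain ⟨hv, hf⟩ := hf
  obtain ⟨hw, hg⟩ := hg
  refine ⟨by omega, fun k => ?_⟩
  change p (WajsbergAlgebra.powImpFun f g k) ↔ _
  rw [hp.powImpFun]
  have hk := k.2
  constructor
  · intro h
    by_contra hc
    have h1 := h ⟨v + 1, by omega⟩ ⟨v + k.1, by omega⟩ (by dsimp only; omega)
    rw [hf, hg] at h1
    have := h1 (by dsimp only; omega)
    dsimp only at this
    omega
  · intro h i j e hi
    rw [hf] at hi
    rw [hg]
    omega

theorem IsPt.cut_neg {p : B → Prop} (hp : IsPt p) {f : Pow n B} {v : ℕ} (hf : IsCut p f v) :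
    IsCut p (powNeg f) (n - v) := by
  obtain ⟨hv, hf⟩ := hf
  refine ⟨by omega, fun k => ?_⟩
  have hk := k.2
  change p (f ⟨n + 1 - k.1, _⟩)ᶜ ↔ _
  rw [hp.compl, hf]
  dsimp only
  omega

theorem IsPt.cut_one {p : B → Prop} (hp : IsPt p) : IsCut p (powOne : Pow n B) 0 :=
  ⟨by omega, fun k => ⟨fun _ => by have := k.2; omega, fun _ => hp.top⟩⟩

theorem IsCut.unique {p : B → Prop} {f : Pow n B} {v w : ℕ} (h : IsCut p f v) (h' : IsCut p f w) :
    v = w := by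
  obtain ⟨hv, h⟩ := h
  obtain ⟨hw, h'⟩ := h'
  rcases lt_trichotomy v w with hlt | he | hlt
  · have := (h ⟨w, by omega⟩).symm.trans (h' ⟨w, by omega⟩)
    dsimp only at this; omega
  · exact he
  · have := (h ⟨v, by omega⟩).symm.trans (h' ⟨v, by omega⟩)
    dsimp only at this; omega

theorem pow_ext {f g : Pow n B}
    (h : ∀ p : B → Prop, IsPt p → ∀ v w, IsCut p f v → IsCut p g w → v = w) : f = g := by
  have key : ∀ p : B → Prop, IsPt p → ∀ i, p (f i) ↔ p (g i) := by
    intro p hp i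
    obtain ⟨v, hv⟩ := hp.exists_cut f
    obtain ⟨w, hw⟩ := hp.exists_cut g
    rw [hv.2, hw.2, h p hp v w hv hw]
  refine OrderHom.ext _ _ (funext fun i => le_antisymm ?_ ?_)
  · by_contra hc
    obtain ⟨p, hp, h1, h2⟩ := exists_pt hc
    exact h2 ((key p hp i).1 h1)
  · by_contra hc
    obtain ⟨p, hp, h1, h2⟩ := exists_pt hc
    exact h2 ((key p hp i).2 h1)

/-- `B^{[n]}` is a Wajsberg algebra. -/
instance : WajsbergAlgebra (Pow n B) where
  imp := powImp
  neg := powNeg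
  one := powOne
  one_imp f := pow_ext fun p hp v w hv hw => by
    have := hv.unique (hp.cut_imp hp.cut_one hw); omega
  imp_trans f g k := pow_ext fun p hp v w hv hw => by
    obtain ⟨a, ha⟩ := hp.exists_cut f
    obtain ⟨b, hb⟩ := hp.exists_cut g
    obtain ⟨c, hc⟩ := hp.exists_cut k
    have h1 := hv.unique (hp.cut_imp (hp.cut_imp ha hb)
      (hp.cut_imp (hp.cut_imp hb hc) (hp.cut_imp ha hc)))
    have h2 := hw.unique hp.cut_one
    omega
  imp_imp_comm f g := pow_ext fun p hp v w hv hw => by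
    obtain ⟨a, ha⟩ := hp.exists_cut f
    obtain ⟨b, hb⟩ := hp.exists_cut g
    have h1 := hv.unique (hp.cut_imp (hp.cut_imp ha hb) hb)
    have h2 := hw.unique (hp.cut_imp (hp.cut_imp hb ha) ha)
    have := ha.1
    have := hb.1
    omega
  contra f g := pow_ext fun p hp v w hv hw => by
    obtain ⟨a, ha⟩ := hp.exists_cut f
    obtain ⟨b, hb⟩ := hp.exists_cut g
    have h1 := hv.unique (hp.cut_imp (hp.cut_imp (hp.cut_neg hb) (hp.cut_neg ha))
      (hp.cut_imp ha hb))
    have h2 := hw.unique hp.cut_one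
    have := ha.1
    have := hb.1
    omega

end Pow

/-! ### Divisors, the class `B^{n+1}` and the algebra `M(B,h)` -/

/-- The positive divisors of `n`. -/
abbrev Divs (n : ℕ) : Type := {d : ℕ // d ∈ n.divisors}

namespace Divs

variable {n : ℕ}

theorem pos (d : Divs n) : 0 < d.1 := Nat.pos_of_mem_divisors d.2

theorem mul_div (d : Divs n) : d.1 * (n / d.1) = n :=
  Nat.mul_div_cancel' (Nat.dvd_of_mem_divisors d.2)

theorem div_pos (d : Divs n) : 0 < n / d.1 :=
  Nat.div_pos (Nat.divisor_le d.2) d.pos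

/-- The greatest common divisor, the meet in the lattice of divisors. -/
def gcd (d e : Divs n) : Divs n :=
  ⟨Nat.gcd d.1 e.1, Nat.mem_divisors.2
    ⟨(Nat.gcd_dvd_left _ _).trans (Nat.dvd_of_mem_divisors d.2), (Nat.mem_divisors.1 d.2).2⟩⟩

/-- `n` as a divisor of `n`. -/
def top (n : ℕ) [NeZero n] : Divs n := ⟨n, Nat.mem_divisors_self n (NeZero.ne n)⟩

/-- The index `q (n/d)`, the last one of the `q`-th block determined by `d`. -/
def last (d : Divs n) (q : Idx d.1) : Idx n :=
  ⟨q.1 * (n / d.1), Nat.mul_pos q.2.1 d.div_pos,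
    (Nat.mul_le_mul_right _ q.2.2).trans d.mul_div.le⟩

/-- The index `(q-1)(n/d) + 1`, the first one of the `q`-th block determined by `d`. -/
def first (d : Divs n) (q : Idx d.1) : Idx n :=
  ⟨(q.1 - 1) * (n / d.1) + 1, Nat.le_add_left _ _, by
    have h1 := (d.last q).2.2
    have h2 := d.div_pos
    have h3 := q.2.1
    have h4 : (q.1 - 1) * (n / d.1) + n / d.1 = q.1 * (n / d.1) := by
      conv_rhs => rw [← Nat.sub_add_cancel h3, Nat.add_mul, Nat.one_mul]
    have h5 : q.1 * (n / d.1) ≤ n := h1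
    omega⟩

end Divs

section M

variable {n : ℕ} {B : Type*} [BooleanAlgebra B]

/-- `ξ_{d,q}(f) = f(q (n/d)) → f((q-1)(n/d) + 1)`. -/
def xi (d : Divs n) (q : Idx d.1) (f : Pow n B) : B := f (d.last q) ⇨ f (d.first q)

theorem xi_neg (d : Divs n) (q : Idx d.1) (f : Pow n B) :
    ∃ q' : Idx d.1, xi d q ∼f = xi d q' f := by
  have hq := q.2
  refine ⟨⟨d.1 - q.1 + 1, by omega⟩, ?_⟩
  have e1 : n + 1 - q.1 * (n / d.1) = (d.1 - q.1 + 1 - 1) * (n / d.1) + 1 := by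
    have h1 : (d.1 - q.1) * (n / d.1) + q.1 * (n / d.1) = n := by
      rw [← Nat.add_mul, Nat.sub_add_cancel hq.2, d.mul_div]
    rw [Nat.add_sub_cancel]; omega
  have e2 : n + 1 - ((q.1 - 1) * (n / d.1) + 1) = (d.1 - q.1 + 1) * (n / d.1) := by
    have h1 : (d.1 - q.1 + 1) * (n / d.1) + (q.1 - 1) * (n / d.1) = n := by
      rw [← Nat.add_mul, show d.1 - q.1 + 1 + (q.1 - 1) = d.1 by omega, d.mul_div]
    omega
  change (f ⟨n + 1 - q.1 * (n / d.1), _⟩)ᶜ ⇨ (f ⟨n + 1 - ((q.1 - 1) * (n / d.1) + 1), _⟩)ᶜ =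
    f ⟨(d.1 - q.1 + 1) * (n / d.1), _⟩ ⇨ f ⟨(d.1 - q.1 + 1 - 1) * (n / d.1) + 1, _⟩
  simp only [e1, e2, himp_eq, compl_compl, sup_comm]

theorem xi_imp (d : Divs n) (q : Idx d.1) (f g : Pow n B) {F : PFilter B}
    (hf : ∀ r, xi d r f ∈ F) (hg : ∀ r, xi d r g ∈ F) : xi d q (f ⇝ g) ∈ F := by
  have hq := q.2
  have hm := d.div_pos
  have hdm := d.mul_div
  -- reduction to the individual terms of the meet that defines the right-hand side
  have hfin : ∀ (s : Finset {i // i ∈ Finset.Icc 1 (n - (d.first q).1 + 1)}) (a : B)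
      (u : {i // i ∈ Finset.Icc 1 (n - (d.first q).1 + 1)} → B),
      (∀ i ∈ s, a ⇨ u i ∈ F) → a ⇨ s.inf u ∈ F := by
    intro s a u
    classical
    induction s using Finset.induction_on with
    | empty => intro _; simp
    | insert i s hi ih =>
      intro h
      rw [Finset.inf_insert, himp_inf_distrib]
      exact PFilter.inf_mem (h i (Finset.mem_insert_self _ _))
        (ih fun j hj => h j (Finset.mem_insert_of_mem hj))
  change powImpFun f g (d.last q) ⇨ powImpFun f g (d.first q) ∈ F
  refine hfin _ _ _ ?_
  rintro ⟨r, hr⟩ -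
  have hr' := Finset.mem_Icc.1 hr
  have hq1 : (q.1 - 1) * (n / d.1) + (n / d.1) = q.1 * (n / d.1) := by
    conv_rhs => rw [← Nat.sub_add_cancel hq.1, Nat.add_mul, Nat.one_mul]
  have hqd : q.1 * (n / d.1) + (d.1 - q.1) * (n / d.1) = n := by
    rw [← Nat.add_mul, Nat.add_sub_cancel' hq.2, d.mul_div]
  have hfirst : (d.first q).1 = (q.1 - 1) * (n / d.1) + 1 := rfl
  have hlast : (d.last q).1 = q.1 * (n / d.1) := rfl
  -- the block `t + 1` that contains `r`
  obtain ⟨t, ht1, ht2⟩ : ∃ t, t * (n / d.1) + 1 ≤ r ∧ r ≤ (t + 1) * (n / d.1) := by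
    refine ⟨(r - 1) / (n / d.1), ?_, ?_⟩
    · have := Nat.div_mul_le_self (r - 1) (n / d.1); omega
    · have := Nat.lt_succ_iff.1 (Nat.lt_succ_of_lt (Nat.lt_mul_div_succ (r - 1) hm))
      have h2 := Nat.lt_mul_div_succ (r - 1) hm
      rw [Nat.mul_comm] at h2; omega
  have ht3 : (t + 1) * (n / d.1) = t * (n / d.1) + n / d.1 := by ring
  have htd : t + q.1 ≤ d.1 := by
    by_contra hc
    have h1 : d.1 - q.1 + 1 ≤ t := by omega
    have h2 := Nat.mul_le_mul_right (n / d.1) h1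
    have h3 : (d.1 - q.1 + 1) * (n / d.1) = (d.1 - q.1) * (n / d.1) + n / d.1 := by ring
    omega
  have hE1 := hf ⟨t + 1, by omega⟩
  have hE2 := hg ⟨t + q.1, by omega⟩
  refine PFilter.mem_of_le ?_ (PFilter.inf_mem hE1 hE2)
  have htq : (t + q.1) * (n / d.1) = t * (n / d.1) + q.1 * (n / d.1) := by ring
  have htq1 : (t + q.1 - 1) * (n / d.1) = t * (n / d.1) + (q.1 - 1) * (n / d.1) := by
    rw [Nat.add_sub_assoc hq.1, Nat.add_mul]
  have hle : (t + q.1) * (n / d.1) ≤ n := by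
    have := Nat.mul_le_mul_right (n / d.1) htd
    omega
  have key := le_powImpFun.1 (le_refl (powImpFun f g (d.last q)))
    ⟨t * (n / d.1) + 1, by omega, by omega⟩ ⟨(t + q.1) * (n / d.1), by omega, hle⟩
    (by dsimp only; omega)
  have m1 : f ⟨r, by omega⟩ ≤ f (d.last ⟨t + 1, by omega⟩) := f.monotone (by
    change r ≤ (t + 1) * (n / d.1); omega)
  have m2 : f (d.first ⟨t + 1, by omega⟩) = f ⟨t * (n / d.1) + 1, by omega, by omega⟩ := by
    congr 1
  have m3 : g (d.first ⟨t + q.1, by omega⟩) ≤ g ⟨r + (d.first q).1 - 1, by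
      omega⟩ := g.monotone (by
    change (t + q.1 - 1) * (n / d.1) + 1 ≤ r + (d.first q).1 - 1; omega)
  rw [le_himp_iff, le_himp_iff]
  refine le_trans ?_ m3
  have s1 : xi d ⟨t + 1, by omega⟩ f ⊓ f ⟨r, by omega⟩ ≤ f (d.first ⟨t + 1, by omega⟩) :=
    (inf_le_inf_left _ m1).trans himp_inf_le
  rw [m2] at s1
  rw [le_himp_iff] at key
  have s2 : xi d ⟨t + q.1, by omega⟩ g ⊓ g ⟨(t + q.1) * (n / d.1), by omega, hle⟩ ≤
    g (d.first ⟨t + q.1, by omega⟩) := himp_inf_le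
  refine le_trans (le_inf (inf_le_left.trans (inf_le_left.trans inf_le_right)) ?_) s2
  refine le_trans (le_inf (inf_le_left.trans inf_le_right) ?_) key
  exact le_trans (le_inf (inf_le_left.trans (inf_le_left.trans inf_le_left)) inf_le_right) s1

/-- `M(B,h) = {f ∈ B^{[n]} : ξ_{d,q}(f) ∈ h(d) for all d ∣ n and 1 ≤ q ≤ d}`, as a subalgebra
of `B^{[n]}`. -/
def M (n : ℕ) (B : Type*) [BooleanAlgebra B] (h : Divs n → PFilter B) : Subalg (Pow n B) where
  carrier := {f | ∀ (d : Divs n) (q : Idx d.1), xi d q f ∈ h d}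
  imp_mem hf hg d q := xi_imp d q _ _ (hf d) (hg d)
  neg_mem {f} hf d q := by
    obtain ⟨q', e⟩ := xi_neg d q f
    rw [e]; exact hf d q'
  one_mem d q := by
    change (⊤ : B) ⇨ ⊤ ∈ h d
    simp

/-- `⟨B, h⟩ ∈ B^{n+1}`: `h(n) = {1}` and `h(gcd(d,e)) = h(d) ∨ h(e)` in the lattice of filters. -/
structure IsBPair (n : ℕ) [NeZero n] (B : Type*) [BooleanAlgebra B] (h : Divs n → PFilter B) :
    Prop where
  map_top : (h (Divs.top n) : Set B) = {⊤}
  map_gcd : ∀ d e, IsLUB {h d, h e} (h (d.gcd e))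

/-- `⟨B₁, h₁⟩` and `⟨B₂, h₂⟩` are isomorphic in `B^{n+1}`. -/
def BPairIso {n : ℕ} {B₁ B₂ : Type*} [BooleanAlgebra B₁] [BooleanAlgebra B₂]
    (h₁ : Divs n → PFilter B₁) (h₂ : Divs n → PFilter B₂) : Prop :=
  ∃ φ : B₁ ≃o B₂, ∀ d, φ ⁻¹' (h₂ d : Set B₂) = h₁ d

end M

/-- `h_A(d) = P_d ∩ B(A)`, where `P_d` is the intersection of all prime implicative filters `P`
of `A` with `A/P ⊆ L_{d+1}`. -/
def hA (n : ℕ) (A : Type*) [WajsbergAlgebra A] (d : Divs n) : PFilter (BooleanPart A) :=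
  IsPFilter.toPFilter (F := {b : BooleanPart A |
      ∀ P : ImplFilter A, P.IsPrime → EmbedsInLuk P.Quot d.1 → b.1 ∈ P.carrier}) <| by
    refine IsPFilter.of_def ⟨⊤, fun P _ _ => P.one_mem⟩ ?_ ?_
    · intro x hx y hy
      refine ⟨x ⊓ y, fun P hP hd => ?_, inf_le_left, inf_le_right⟩
      have h1 : Le x.1 (y.1 ⇝ (x ⊓ y).1) := by
        change Le x.1 (y.1 ⇝ wedge x.1 y.1)
        unfold Le
        rw [wedge_eq_odot x.2, ← odot_imp]
        exact le_rfl' _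
      exact P.mp (hy P hP hd) (ImplFilter.mem_of_le h1 (hx P hP hd))
    · intro x y hxy hx P hP hd
      exact ImplFilter.mem_of_le hxy (hx P hP hd)

/-! ### Stone spaces and `(n+1)`-valued Boolean spaces -/

/-- The Stone space `χ(B)`: the set of prime filters of `B`. -/
def StoneSpace (B : Type*) [BooleanAlgebra B] : Type _ := {U : PFilter B // U.IsPrime}

/-- `s(a) = {U ∈ χ(B) : a ∈ U}`. -/
def stoneSet {B : Type*} [BooleanAlgebra B] (a : B) : Set (StoneSpace B) := {U | a ∈ U.1}

/-- The topology with basis the sets `s(a)`. -/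
instance {B : Type*} [BooleanAlgebra B] : TopologicalSpace (StoneSpace B) :=
  TopologicalSpace.generateFrom (Set.range stoneSet)

theorem isClosed_stoneSet {B : Type*} [BooleanAlgebra B] (a : B) :
    IsClosed (stoneSet a : Set (StoneSpace B)) := by
  rw [← isOpen_compl_iff]
  refine TopologicalSpace.isOpen_generateFrom_of_mem ⟨aᶜ, ?_⟩
  ext ⟨U, hU⟩
  change aᶜ ∈ U ↔ a ∉ U
  constructor
  · intro h h'
    obtain ⟨z, hz⟩ := hU.compl_ideal.2
    exact hz (PFilter.mem_of_le (by rw [inf_compl_eq_bot]; exact bot_le) (PFilter.inf_mem h' h))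
  · intro h
    by_contra hc
    obtain ⟨z, hz, h1, h2⟩ := hU.compl_ideal.3 a h aᶜ hc
    have h3 : a ⊔ aᶜ ≤ z := sup_le h1 h2
    rw [sup_compl_eq_top] at h3
    exact hz (PFilter.mem_of_le h3 PFilter.top_mem)

/-- `δ(F) = ⋂ {s(x) : x ∈ F}`, a closed subset of `χ(B)`. -/
def delta {B : Type*} [BooleanAlgebra B] (F : PFilter B) : TopologicalSpace.Closeds (StoneSpace B) :=
  ⟨⋂ x ∈ F, stoneSet x, isClosed_biInter fun x _ => isClosed_stoneSet x⟩

/-- `⟨X, h⟩` is an `(n+1)`-valued Boolean space. -/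
structure IsValuedBooleanSpace (n : ℕ) [NeZero n] (X : Type*) [TopologicalSpace X]
    (h : Divs n → TopologicalSpace.Closeds X) : Prop where
  compact : CompactSpace X
  hausdorff : T2Space X
  totallyDisconnected : TotallyDisconnectedSpace X
  map_gcd : ∀ d e, h (d.gcd e) = h d ⊓ h e
  map_top : h (Divs.top n) = ⊤

/-- `⟨X, h⟩` and `⟨Y, g⟩` are isomorphic. -/
def SpaceIso {n : ℕ} {X Y : Type*} [TopologicalSpace X] [TopologicalSpace Y]
    (h : Divs n → TopologicalSpace.Closeds X) (g : Divs n → TopologicalSpace.Closeds Y) : Prop :=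
  ∃ φ : X ≃ₜ Y, ∀ d, φ ⁻¹' (g d : Set Y) = h d

theorem continuous_neg' {X : Type*} [TopologicalSpace X] {f : X → unitInterval}
    (hf : Continuous f) : Continuous (∼f) :=
  Continuous.subtype_mk (continuous_const.sub (continuous_subtype_val.comp hf)) _

theorem continuous_imp' {X : Type*} [TopologicalSpace X] {f g : X → unitInterval}
    (hf : Continuous f) (hg : Continuous g) : Continuous (f ⇝ g) :=
  Continuous.subtype_mk (continuous_const.min
    ((continuous_const.sub (continuous_subtype_val.comp hf)).add
      (continuous_subtype_val.comp hg))) _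

/-- The algebra of the continuous functions `f : X → L_{n+1}` with `f(h(d)) ⊆ L_{d+1}` for every
divisor `d` of `n`, with the pointwise operations. -/
def Cfun (n : ℕ) [NeZero n] (X : Type*) [TopologicalSpace X]
    (h : Divs n → TopologicalSpace.Closeds X) : Subalg (X → unitInterval) where
  carrier := {f | Continuous f ∧ (∀ x, f x ∈ Luk n) ∧ ∀ d : Divs n, ∀ x ∈ h d, f x ∈ Luk d.1}
  imp_mem hf hg := ⟨continuous_imp' hf.1 hg.1,
    fun x => imp_mem_Luk (NeZero.pos n) (hf.2.1 x) (hg.2.1 x),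
    fun d x hx => imp_mem_Luk d.pos (hf.2.2 d x hx) (hg.2.2 d x hx)⟩
  neg_mem hf := ⟨continuous_neg' hf.1, fun x => neg_mem_Luk (NeZero.pos n) (hf.2.1 x),
    fun d x hx => neg_mem_Luk d.pos (hf.2.2 d x hx)⟩
  one_mem := ⟨continuous_const, fun _ => one_mem_Luk (NeZero.pos n), fun d _ _ => one_mem_Luk d.pos⟩

/-- `g̃ : χ(B) → L_{n+1}` is the function associated with `g ∈ B^{[n]}`: it takes the value `1` on
`S₁`, the value `k/n` on `S_{n-k+1} ∖ S_{n-k}` for `1 ≤ k ≤ n-1`, and the value `0` outside `S_n`,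
where `S_i = s(g(i))`. -/
def IsTilde {n : ℕ} {B : Type*} [BooleanAlgebra B] (g : Pow n B)
    (gt : StoneSpace B → unitInterval) : Prop :=
  ∀ U : StoneSpace B,
    (∀ i : Idx n, i.1 = 1 → U ∈ stoneSet (g i) → (gt U : ℝ) = 1) ∧
    (∀ (k : ℕ) (i j : Idx n), 1 ≤ k → k ≤ n - 1 → i.1 = n - k + 1 → j.1 = n - k →
      U ∈ stoneSet (g i) \ stoneSet (g j) → (gt U : ℝ) = (k : ℝ) / n) ∧
    (∀ i : Idx n, i.1 = n → U ∉ stoneSet (g i) → (gt U : ℝ) = 0)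

/-! ### The statements that are compared -/

/-- The map `x ↦ (i ↦ σ_i(x))` is an isomorphism from `A` onto `M(B(A), h_A)`. -/
def SigmaIso (n : ℕ) (A : Type*) [WajsbergAlgebra A] : Prop :=
  ∃ φ : Iso A (M n (BooleanPart A) (hA n A)).Elem,
    ∀ (x : A) (i : Idx n), ((φ.toFun x).1 i).1 = sigma n i.1 x

/-- `⟨X, h⟩` is an `(n+1)`-valued Boolean space that represents `A`. -/
def Represents (n : ℕ) [NeZero n] (A : Type*) [WajsbergAlgebra A] (X : Type*) [TopologicalSpace X]
    (h : Divs n → TopologicalSpace.Closeds X) : Prop :=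
  IsValuedBooleanSpace n X h ∧ Nonempty (Iso A (Cfun n X h).Elem)

/-- The `(n+1)`-valued Boolean spaces that represent `A` exist, are all isomorphic to each other,
and are homeomorphic to the Stone space of `B(A)`. -/
def UniquelyRepresentable (n : ℕ) [NeZero n] (A : Type u) [WajsbergAlgebra A] : Prop :=
  (∃ (X : Type u) (_ : TopologicalSpace X) (h : Divs n → TopologicalSpace.Closeds X),
    Represents n A X h) ∧
  (∀ (X : Type v) (Y : Type w) [TopologicalSpace X] [TopologicalSpace Y]
    (h : Divs n → TopologicalSpace.Closeds X) (g : Divs n → TopologicalSpace.Closeds Y),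
    Represents n A X h → Represents n A Y g → SpaceIso h g) ∧
  (∀ (X : Type v) [TopologicalSpace X] (h : Divs n → TopologicalSpace.Closeds X),
    Represents n A X h → Nonempty (X ≃ₜ StoneSpace (BooleanPart A)))

end WajsbergAlgebra

/-!
An `(n+1)`-valued algebra `A` is separated by its homomorphisms into `L_{n+1}`. Such a homomorphism
`g` is determined by its restriction to `B(A)`, because `g x = j / n` can be read off from which of
the idempotents `σ_i x` it sends to `1`; and every point of `χ(B(A))` arises from some `g`, because
the `σ_i` embed `A` into `B(A)^[n]`, whose elements a point of `χ(B(A))` evaluates in `L_{n+1}`.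
So the homomorphisms `A → L_{n+1}` are the points of `χ(B(A))`, and those with values in `L_{d+1}`
form the closed set `δ(h_A(d))`. An element of `M(B(A), h_A)` agrees at each point, hence on a
neighbourhood of it, with the image of some `x ∈ A`; compactness and patching by idempotents make
it the image of a single `x`, which is (I).

A space `X` representing `A` is recovered in the same way: the evaluations at its points are
homomorphisms `A → L_{n+1}`, and this maps `X` homeomorphically onto `χ(B(A))`, with `h(d)`
going to `δ(h_A(d))`. Conversely, each of (I) and (II) embeds `A` into a product of copies of
`L_{n+1}`, and so makes `A` an `(n+1)`-valued algebra.
-/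

namespace WajsbergAlgebra

/-! ### The algebras `[0,1]` and `L_{d+1}` -/

section UnitInterval

theorem coe_imp (x y : unitInterval) : ((x ⇝ y : unitInterval) : ℝ) = min 1 (1 - (x : ℝ) + y) :=
  rfl

theorem coe_neg (x : unitInterval) : ((∼x : unitInterval) : ℝ) = 1 - (x : ℝ) := rfl

theorem coe_one : ((one : unitInterval) : ℝ) = 1 := rfl

theorem coe_zero : ((zero : unitInterval) : ℝ) = 0 := sub_self _

theorem zero_ne_one_unitInterval : (zero : unitInterval) ≠ one := fun h =>
  zero_ne_one (coe_zero.symm.trans (congrArg Subtype.val h))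

theorem coe_vee (x y : unitInterval) : ((vee x y : unitInterval) : ℝ) = max (x : ℝ) y := by
  have := x.2.2; have := y.2.2
  simp only [vee, coe_imp, min_def, max_def]; split_ifs <;> linarith

theorem coe_odot (x y : unitInterval) :
    ((odot x y : unitInterval) : ℝ) = max 0 ((x : ℝ) + y - 1) := by
  simp only [odot, coe_imp, coe_neg, min_def, max_def]; split_ifs <;> linarith

theorem eq_zero_or_one_of_odot_self {x : unitInterval} (h : odot x x = x) :
    x = zero ∨ x = one := by
  have h' := congrArg Subtype.val h
  simp only [Subtype.ext_iff, coe_zero, coe_one]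
  rw [coe_odot] at h'
  rcases max_cases 0 ((x : ℝ) + x - 1) with ⟨e, -⟩ | ⟨e, -⟩
  · exact Or.inl (h'.symm.trans e)
  · exact Or.inr (by linarith)

theorem mem_Luk_iff {d : ℕ} (hd : 0 < d) {x : unitInterval} :
    x ∈ Luk d ↔ ∃ z : ℤ, (d : ℝ) * x = z := by
  have hd' : (0 : ℝ) < d := by exact_mod_cast hd
  constructor
  · rintro ⟨k, -, e⟩
    exact ⟨k, by rw [e]; push_cast; field_simp⟩
  · rintro ⟨z, e⟩
    have z_nonneg : 0 ≤ z := by exact_mod_cast e ▸ mul_nonneg hd'.le x.2.1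
    have z_le : z ≤ d := by exact_mod_cast e ▸ mul_le_of_le_one_right hd'.le x.2.2
    lift z to ℕ using z_nonneg
    exact ⟨z, by exact_mod_cast z_le, by rw [eq_div_iff hd'.ne', mul_comm, e]; simp⟩

theorem Luk_subset_Luk_iff {d e : ℕ} (hd : 0 < d) (he : 0 < e) : Luk d ⊆ Luk e ↔ d ∣ e := by
  have hd' : (0 : ℝ) < d := by exact_mod_cast hd
  have he' : (0 : ℝ) < e := by exact_mod_cast he
  constructor
  · intro h
    obtain ⟨k, -, hk⟩ := @h ⟨1 / d, by positivity, by
      rw [div_le_one hd']; exact_mod_cast hd⟩ ⟨1, hd, by push_cast; rfl⟩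
    rw [div_eq_div_iff hd'.ne' he'.ne', one_mul, mul_comm] at hk
    exact ⟨k, by exact_mod_cast hk⟩
  · rintro ⟨c, rfl⟩ x hx
    obtain ⟨z, hz⟩ := (mem_Luk_iff hd).1 hx
    exact (mem_Luk_iff he).2 ⟨c * z, by push_cast; rw [← hz]; ring⟩

theorem Luk_gcd {d e : ℕ} (hd : 0 < d) (he : 0 < e) : Luk (d.gcd e) = Luk d ∩ Luk e := by
  have hg := Nat.gcd_pos_of_pos_left e hd
  refine Set.Subset.antisymm (Set.subset_inter
    ((Luk_subset_Luk_iff hg hd).2 (d.gcd_dvd_left e))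
    ((Luk_subset_Luk_iff hg he).2 (d.gcd_dvd_right e))) ?_
  rintro x ⟨hxd, hxe⟩
  obtain ⟨y, hy⟩ := (mem_Luk_iff hd).1 hxd
  obtain ⟨z, hz⟩ := (mem_Luk_iff he).1 hxe
  refine (mem_Luk_iff hg).2 ⟨y * d.gcdA e + z * d.gcdB e, ?_⟩
  have bezout : ((d.gcd e : ℕ) : ℝ) = d * d.gcdA e + e * d.gcdB e := by
    exact_mod_cast Nat.gcd_eq_gcd_ab d e
  rw [bezout]
  push_cast
  rw [← hy, ← hz]
  ring

theorem finite_Luk (d : ℕ) : (Luk d).Finite := by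
  refine Set.Finite.of_finite_image (f := Subtype.val) ?_ Subtype.val_injective.injOn
  refine ((Set.finite_Iic d).image fun k : ℕ => (k : ℝ) / d).subset ?_
  rintro _ ⟨x, ⟨k, hk, e⟩, rfl⟩
  exact ⟨k, hk, e.symm⟩

end UnitInterval

/-- The element `1 - v/n` of `L_{n+1}`, for `v ≤ n`. Counting down from `1` turns `→` into truncated
subtraction of natural numbers, and matches the thresholds of `IsCut`. -/
noncomputable def atDepth (n v : ℕ) : unitInterval :=
  ⟨((n - v : ℕ) : ℝ) / n, by positivity,
    div_le_one_of_le₀ (Nat.cast_le.2 (Nat.sub_le n v)) n.cast_nonneg⟩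

section AtDepth

variable {n v w : ℕ}

theorem coe_atDepth (n v : ℕ) : (atDepth n v : ℝ) = ((n - v : ℕ) : ℝ) / n := rfl

theorem atDepth_mem_Luk (n v : ℕ) : atDepth n v ∈ Luk n := ⟨n - v, Nat.sub_le _ _, rfl⟩

theorem exists_eq_atDepth {x : unitInterval} (hx : x ∈ Luk n) : ∃ v ≤ n, x = atDepth n v := by
  obtain ⟨k, hk, e⟩ := hx
  exact ⟨n - k, Nat.sub_le _ _, Subtype.ext (by rw [coe_atDepth, Nat.sub_sub_self hk, e])⟩

theorem coe_atDepth_eq_one_sub [NeZero n] (hv : v ≤ n) : (atDepth n v : ℝ) = 1 - v / n := by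
  rw [coe_atDepth, Nat.cast_sub hv, sub_div, div_self (Nat.cast_ne_zero.2 (NeZero.ne n))]

theorem atDepth_le_atDepth [NeZero n] (hv : v ≤ n) (hw : w ≤ n) :
    atDepth n v ≤ atDepth n w ↔ w ≤ v := by
  have hn : (0 : ℝ) < n := by exact_mod_cast NeZero.pos n
  rw [← Subtype.coe_le_coe, coe_atDepth_eq_one_sub hv, coe_atDepth_eq_one_sub hw,
    sub_le_sub_iff_left, div_le_div_iff_of_pos_right hn, Nat.cast_le]

theorem atDepth_inj [NeZero n] (hv : v ≤ n) (hw : w ≤ n) :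
    atDepth n v = atDepth n w ↔ v = w := by
  rw [le_antisymm_iff, atDepth_le_atDepth hv hw, atDepth_le_atDepth hw hv, and_comm,
    ← le_antisymm_iff]

theorem atDepth_zero [NeZero n] : atDepth n 0 = one :=
  Subtype.ext (by simp [coe_atDepth_eq_one_sub, coe_one])

theorem atDepth_self (n : ℕ) : atDepth n n = zero :=
  Subtype.ext (by rw [coe_atDepth, coe_zero, Nat.sub_self, Nat.cast_zero, zero_div])

theorem atDepth_imp [NeZero n] (hv : v ≤ n) (hw : w ≤ n) :
    atDepth n v ⇝ atDepth n w = atDepth n (w - v) := by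
  have hn : (0 : ℝ) < n := by exact_mod_cast NeZero.pos n
  refine Subtype.ext ?_
  rw [coe_imp, coe_atDepth_eq_one_sub hv, coe_atDepth_eq_one_sub hw,
    coe_atDepth_eq_one_sub (by omega)]
  rcases le_total v w with h | h
  · have : (v : ℝ) / n ≤ w / n := by gcongr
    rw [min_eq_right (by linarith), Nat.cast_sub h]
    ring
  · have : (w : ℝ) / n ≤ v / n := by gcongr
    rw [min_eq_left (by linarith), Nat.sub_eq_zero_of_le h]
    simp

theorem neg_atDepth [NeZero n] (hv : v ≤ n) : ∼(atDepth n v) = atDepth n (n - v) := by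
  rw [← imp_zero, ← atDepth_self n, atDepth_imp hv le_rfl]

theorem atDepth_mem_Luk_iff (d : Divs n) (hv : v ≤ n) :
    atDepth n v ∈ Luk d.1 ↔ n / d.1 ∣ v := by
  have : NeZero n := ⟨(Nat.mem_divisors.1 d.2).2⟩
  obtain ⟨m, hm⟩ : ∃ m, n / d.1 = m := ⟨_, rfl⟩
  have hd : (d.1 : ℝ) ≠ 0 := by exact_mod_cast d.pos.ne'
  have hm0 : (m : ℝ) ≠ 0 := by exact_mod_cast (hm ▸ d.div_pos).ne'
  have hdm : (n : ℝ) = d.1 * m := by exact_mod_cast hm ▸ d.mul_div.symm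
  have scaled : (d.1 : ℝ) * atDepth n v = d.1 - v / m := by
    rw [coe_atDepth_eq_one_sub hv, hdm]
    field_simp
  rw [mem_Luk_iff d.pos, scaled, hm, ← Int.natCast_dvd_natCast]
  constructor
  · rintro ⟨z, hz⟩
    rw [sub_eq_iff_eq_add, ← sub_eq_iff_eq_add', eq_div_iff hm0] at hz
    exact ⟨d.1 - z, by rw [mul_comm]; exact_mod_cast hz.symm⟩
  · rintro ⟨c, hc⟩
    have hc' : (v : ℝ) = m * c := by exact_mod_cast hc
    exact ⟨d.1 - c, by rw [hc', mul_div_cancel_left₀ _ hm0]; push_cast; rfl⟩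

theorem sigma_atDepth [NeZero n] (i : ℕ) (hv : v ≤ n) :
    sigma n i (atDepth n v) = if v < i then one else zero := by
  have h : n < i + (n - v) ↔ v < i := by omega
  refine Subtype.ext ((sigma_Luk (NeZero.pos n) _ (coe_atDepth n v)).trans ?_)
  simp only [h]
  split_ifs
  exacts [coe_one.symm, coe_zero.symm]

end AtDepth

theorem exists_forall_mem_iff_dvd_of_sub_mem {n : ℕ} {D : Set ℕ} (hn : 0 < n) (hnD : n ∈ D)
    (hsub : ∀ j ∈ D, ∀ k ∈ D, j - k ∈ D) : ∃ m, m ∣ n ∧ ∀ j ≤ n, j ∈ D ↔ m ∣ j := by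
  classical
  obtain ⟨m, ⟨hm0, hmD⟩, hmin⟩ : ∃ m, (0 < m ∧ m ∈ D) ∧ ∀ j, 0 < j ∧ j ∈ D → m ≤ j :=
    have hex : ∃ m, 0 < m ∧ m ∈ D := ⟨n, hn, hnD⟩
    ⟨Nat.find hex, Nat.find_spec hex, fun _ => Nat.find_min' hex⟩
  have dvd_of_mem : ∀ j ∈ D, m ∣ j := by
    intro j
    induction j using Nat.strong_induction_on with
    | _ j ih =>
      intro hj
      rcases j.eq_zero_or_pos with rfl | h0
      · exact dvd_zero m
      · have hle := hmin j ⟨h0, hj⟩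
        exact (Nat.dvd_sub_iff_left hle dvd_rfl).1 (ih (j - m) (by omega) (hsub j hj m hmD))
  have mul_mem : ∀ c, m * c ≤ n → m * c ∈ D := by
    intro c
    induction c with
    | zero => exact fun _ => by simpa using hsub n hnD n hnD
    | succ c ih =>
      intro hc
      have e : m * (c + 1) = n - (n - m * c - m) := by rw [mul_add_one] at hc ⊢; omega
      rw [mul_add_one] at hc
      exact e ▸ hsub n hnD _ (hsub _ (hsub n hnD _ (ih (by omega))) m hmD)
  refine ⟨m, dvd_of_mem n hnD, fun j hj => ⟨dvd_of_mem j, ?_⟩⟩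
  rintro ⟨c, rfl⟩
  exact mul_mem c hj

theorem Subalg.exists_carrier_eq_Luk {n : ℕ} [NeZero n] (S : Subalg unitInterval)
    (hS : S.carrier ⊆ Luk n) : ∃ d : Divs n, S.carrier = Luk d.1 := by
  have hn := NeZero.pos n
  let D : Set ℕ := {v | v ≤ n ∧ atDepth n v ∈ S.carrier}
  have zero_mem : zero ∈ S.carrier := S.neg_mem S.one_mem
  obtain ⟨m, hmn, hm⟩ : ∃ m, m ∣ n ∧ ∀ v ≤ n, v ∈ D ↔ m ∣ v :=
    exists_forall_mem_iff_dvd_of_sub_mem hn ⟨le_rfl, (atDepth_self n).symm ▸ zero_mem⟩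
      fun v hv w hw => ⟨(Nat.sub_le _ _).trans hv.1, atDepth_imp hw.1 hv.1 ▸ S.imp_mem hw.2 hv.2⟩
  let d : Divs n := ⟨n / m, Nat.mem_divisors.2 ⟨Nat.div_dvd_of_dvd hmn, hn.ne'⟩⟩
  have hdm : n / d.1 = m := Nat.div_div_self hmn hn.ne'
  have hd : Luk d.1 ⊆ Luk n := (Luk_subset_Luk_iff d.pos hn).2 (Nat.dvd_of_mem_divisors d.2)
  refine ⟨d, Set.ext fun x => ?_⟩
  suffices h : x ∈ Luk n → (x ∈ S.carrier ↔ x ∈ Luk d.1) from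
    ⟨fun hx => (h (hS hx)).1 hx, fun hx => (h (hd hx)).2 hx⟩
  intro hx
  obtain ⟨v, hv, rfl⟩ := exists_eq_atDepth hx
  rw [atDepth_mem_Luk_iff d hv, hdm, ← hm v hv]
  exact (and_iff_right hv).symm

/-! ### Homomorphisms -/

namespace Hom

variable {A A' A'' : Type*} [WajsbergAlgebra A] [WajsbergAlgebra A'] [WajsbergAlgebra A'']

/-- The composition of two homomorphisms. -/
def comp (g : Hom A' A'') (f : Hom A A') : Hom A A'' where
  toFun x := g.toFun (f.toFun x)
  map_imp x y := by rw [f.map_imp, g.map_imp]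
  map_neg x := by rw [f.map_neg, g.map_neg]
  map_one := by rw [f.map_one, g.map_one]

variable (g : Hom A A')

theorem map_zero : g.toFun zero = zero := by
  rw [zero, g.map_neg, g.map_one, zero]

theorem map_odot (x y : A) : g.toFun (odot x y) = odot (g.toFun x) (g.toFun y) := by
  simp only [odot, g.map_neg, g.map_imp]

theorem map_vee (x y : A) : g.toFun (vee x y) = vee (g.toFun x) (g.toFun y) := by
  simp only [vee, g.map_imp]

theorem map_wedge (x y : A) : g.toFun (wedge x y) = wedge (g.toFun x) (g.toFun y) := by
  simp only [wedge, g.map_neg, g.map_vee]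

theorem map_eval (t : Term) (v : ℕ → A) : g.toFun (t.eval v) = t.eval fun i => g.toFun (v i) := by
  induction t with
  | var i => rfl
  | imp s t hs ht => simp only [Term.eval, g.map_imp, hs, ht]
  | neg t ht => simp only [Term.eval, g.map_neg, ht]
  | one => exact g.map_one

theorem injective_of_forall_eq_one (h : ∀ x, g.toFun x = one → x = one) :
    Function.Injective g.toFun := by
  have le_of_eq {x y : A} (e : g.toFun x = g.toFun y) : Le x y :=
    h _ (by rw [g.map_imp, e]; exact le_rfl' _)
  exact fun x y e => (le_of_eq e).antisymm (le_of_eq e.symm)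

/-- The image of a homomorphism, as a subalgebra of its codomain. -/
def range : Subalg A' where
  carrier := Set.range g.toFun
  imp_mem := by rintro _ _ ⟨x, rfl⟩ ⟨y, rfl⟩; exact ⟨x ⇝ y, g.map_imp x y⟩
  neg_mem := by rintro _ ⟨x, rfl⟩; exact ⟨∼x, g.map_neg x⟩
  one_mem := ⟨one, g.map_one⟩

/-- The implicative filter `g⁻¹(1)`. -/
def ker : ImplFilter A where
  carrier := {x | g.toFun x = one}
  one_mem := g.map_one
  mp {a b} (ha : g.toFun a = one) (hab : g.toFun (a ⇝ b) = one) := by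
    rwa [g.map_imp, ha, one_imp] at hab

theorem isPrime_ker (g : Hom A unitInterval) : g.ker.IsPrime := by
  constructor
  · intro h
    have h0 : zero ∈ g.ker.carrier := h ▸ Set.mem_univ zero
    exact zero_ne_one_unitInterval (g.map_zero.symm.trans h0)
  · intro x y (h : g.toFun (vee x y) = one)
    rw [g.map_vee, Subtype.ext_iff, coe_vee] at h
    rcases max_choice (g.toFun x : ℝ) (g.toFun y) with e | e
    · exact Or.inl (Subtype.ext (e.symm.trans h))
    · exact Or.inr (Subtype.ext (e.symm.trans h))

/-- The homomorphism induced on the quotient by the kernel. -/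
def kerLift : Hom g.ker.Quot A' where
  toFun := Quotient.lift g.toFun fun x y
      ⟨(hxy : g.toFun (x ⇝ y) = one), (hyx : g.toFun (y ⇝ x) = one)⟩ =>
    Le.antisymm ((g.map_imp x y).symm.trans hxy) ((g.map_imp y x).symm.trans hyx)
  map_imp := by rintro ⟨x⟩ ⟨y⟩; exact g.map_imp x y
  map_neg := by rintro ⟨x⟩; exact g.map_neg x
  map_one := g.map_one

theorem kerLift_injective : Function.Injective g.kerLift.toFun := by
  refine g.kerLift.injective_of_forall_eq_one ?_
  rintro ⟨x⟩ (hx : g.toFun x = one)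
  refine Quotient.sound ⟨?_, ?_⟩
  · exact (le_one x).symm ▸ g.map_one
  · exact (one_imp x).symm ▸ hx

theorem embedsInLuk_ker {g : Hom A unitInterval} {d : ℕ} (hg : ∀ x, g.toFun x ∈ Luk d) :
    EmbedsInLuk g.ker.Quot d :=
  ⟨g.kerLift, g.kerLift_injective, by rintro ⟨x⟩; exact hg x⟩

end Hom

/-- The projection onto the quotient by an implicative filter. -/
def ImplFilter.proj {A : Type*} [WajsbergAlgebra A] (F : ImplFilter A) : Hom A F.Quot where
  toFun := Quotient.mk F.con
  map_imp _ _ := rfl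
  map_neg _ := rfl
  map_one := rfl

theorem ImplFilter.mem_of_proj_eq_one {A : Type*} [WajsbergAlgebra A] {F : ImplFilter A} {x : A}
    (h : F.proj.toFun x = one) : x ∈ F.carrier :=
  one_imp x ▸ (Quotient.exact h : F.con x one).2

/-- The inclusion of a subalgebra. -/
def Subalg.incl {A : Type*} [WajsbergAlgebra A] (S : Subalg A) : Hom S.Elem A where
  toFun x := x.1
  map_imp _ _ := rfl
  map_neg _ := rfl
  map_one := rfl

/-- The evaluation of functions at a point. -/
def evalHom {X : Type*} (A : Type*) [WajsbergAlgebra A] (x : X) : Hom (X → A) A where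
  toFun f := f x
  map_imp _ _ := rfl
  map_neg _ := rfl
  map_one := rfl

namespace Iso

variable {A A' A'' : Type*} [WajsbergAlgebra A] [WajsbergAlgebra A'] [WajsbergAlgebra A'']

/-- An isomorphism as a homomorphism. -/
def hom (φ : Iso A A') : Hom A A' where
  toFun := φ.toFun
  map_imp := φ.map_imp
  map_neg := φ.map_neg
  map_one := φ.map_one

/-- A bijective homomorphism, as an isomorphism. -/
noncomputable def ofBijective (g : Hom A A') (hg : Function.Bijective g.toFun) : Iso A A' where
  toEquiv := Equiv.ofBijective g.toFun hg
  map_imp := g.map_imp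
  map_neg := g.map_neg
  map_one := g.map_one

/-- The composition of two isomorphisms. -/
noncomputable def trans (φ : Iso A A') (ψ : Iso A' A'') : Iso A A'' :=
  ofBijective (ψ.hom.comp φ.hom) (ψ.toEquiv.bijective.comp φ.toEquiv.bijective)

end Iso

theorem mem_hA_iff {n : ℕ} {A : Type*} [WajsbergAlgebra A] {d : Divs n} {b : BooleanPart A} :
    b ∈ hA n A d ↔
      ∀ g : Hom A unitInterval, (∀ x, g.toFun x ∈ Luk d.1) → g.toFun b.1 = one := by
  constructor
  · exact fun h g hg => h g.ker g.isPrime_ker (Hom.embedsInLuk_ker hg)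
  · rintro h P - ⟨g, hg, hd⟩
    exact P.mem_of_proj_eq_one (hg ((h (g.comp P.proj) fun x => hd _).trans g.map_one.symm))

theorem isValued_of_separating {n : ℕ} {A : Type*} [WajsbergAlgebra A]
    (h : ∀ x y : A, (∀ g : Hom A unitInterval, (∀ z, g.toFun z ∈ Luk n) → g.toFun x = g.toFun y) →
      x = y) : IsValued n A := by
  intro s t hst v
  refine h _ _ fun g hg => ?_
  rw [g.map_eval, g.map_eval]
  exact hst _ fun i => hg _

theorem Hom.exists_range_eq_Luk {n : ℕ} [NeZero n] {A : Type*} [WajsbergAlgebra A]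
    {g : Hom A unitInterval} (hg : ∀ x, g.toFun x ∈ Luk n) :
    ∃ d : Divs n, Set.range g.toFun = Luk d.1 :=
  g.range.exists_carrier_eq_Luk (Set.range_subset_iff.2 hg)

/-! ### The operators `σ_i` -/

namespace Term

/-- The term that computes `lin`. -/
def lin : ℕ → ℤ → Term → Term
  | 0, b, _ => if b < 0 then one else neg one
  | a + 1, b, t => neg (imp (imp (neg (lin a b t)) t) (neg (lin a (b - 1) t)))

/-- The term that computes `σ_i`. -/
def sigma (n i : ℕ) (t : Term) : Term := lin n (n - i) t

variable {A : Type*} [WajsbergAlgebra A]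

theorem eval_lin (v : ℕ → A) (a : ℕ) (b : ℤ) (t : Term) :
    (lin a b t).eval v = WajsbergAlgebra.lin a b (t.eval v) := by
  induction a generalizing b with
  | zero => unfold lin WajsbergAlgebra.lin; split_ifs <;> rfl
  | succ a ih => simp only [lin, eval, WajsbergAlgebra.lin, ih, odot, oplus]

theorem eval_sigma (v : ℕ → A) (n i : ℕ) (t : Term) :
    (sigma n i t).eval v = WajsbergAlgebra.sigma n i (t.eval v) :=
  eval_lin v _ _ t

end Term

theorem Hom.map_sigma {A A' : Type*} [WajsbergAlgebra A] [WajsbergAlgebra A'] (g : Hom A A')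
    (n i : ℕ) (x : A) : g.toFun (sigma n i x) = sigma n i (g.toFun x) := by
  simpa only [Term.eval_sigma, Term.eval] using g.map_eval (.sigma n i (.var 0)) fun _ => x

section TruthValues

variable {A : Type*} [WajsbergAlgebra A] {P Q : Prop} [Decidable P] [Decidable Q]

theorem neg_ite_one_zero : ∼(if P then one else zero : A) = if ¬P then one else zero := by
  split_ifs
  exacts [rfl, neg_neg' one]

theorem ite_one_zero_imp_ite_one_zero :
    (if P then one else zero : A) ⇝ (if Q then one else zero) = if P → Q then one else zero := by
  by_cases hP : P <;> by_cases hQ : Q <;>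
    simp only [hP, hQ, if_true, if_false, one_imp, imp_true_iff, imp_false, not_true, not_false_iff]
  exacts [le_one _, zero_le' _]

theorem ite_one_zero_le_ite_one_zero (h : P → Q) :
    Le (if P then one else zero : A) (if Q then one else zero) := by
  rw [Le, ite_one_zero_imp_ite_one_zero, if_pos h]

theorem ite_one_zero_odot_self :
    odot (if P then one else zero : A) (if P then one else zero) = if P then one else zero := by
  split_ifs
  exacts [one_odot_one, neg_idem one_odot_one]

end TruthValues

namespace IsValued

variable {n : ℕ} {A : Type*} [WajsbergAlgebra A] (hV : IsValued n A)
include hV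

theorem eval_eq_eval {s t : Term}
    (h : ∀ v : ℕ → ℕ, (∀ i, v i ≤ n) →
      s.eval (fun i => atDepth n (v i)) = t.eval fun i => atDepth n (v i))
    (v : ℕ → A) : s.eval v = t.eval v := by
  refine hV s t (fun v hv => ?_) v
  choose w hw hvw using fun i => exists_eq_atDepth (hv i)
  rw [funext hvw]
  exact h w hw

theorem eval_le_eval {s t : Term}
    (h : ∀ v : ℕ → ℕ, (∀ i, v i ≤ n) →
      Le (s.eval fun i => atDepth n (v i)) (t.eval fun i => atDepth n (v i)))
    (v : ℕ → A) : Le (s.eval v) (t.eval v) :=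
  hV.eval_eq_eval (s := .imp s t) (t := .one) h v

variable [NeZero n]

theorem sigma_odot_self (i : ℕ) (x : A) :
    odot (sigma n i x) (sigma n i x) = sigma n i x := by
  have h := hV.eval_eq_eval (s := .neg (.imp (.sigma n i (.var 0)) (.neg (.sigma n i (.var 0)))))
    (t := .sigma n i (.var 0)) (fun v hv => ?_) fun _ => x
  · simpa only [Term.eval, Term.eval_sigma, odot] using h
  · simp only [Term.eval, Term.eval_sigma, sigma_atDepth i (hv 0)]
    exact ite_one_zero_odot_self

theorem sigma_le_sigma {i j : ℕ} (hij : i ≤ j) (x : A) : Le (sigma n i x) (sigma n j x) := by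
  have h := hV.eval_le_eval (s := .sigma n i (.var 0)) (t := .sigma n j (.var 0))
    (fun v hv => ?_) fun _ => x
  · simpa only [Term.eval, Term.eval_sigma] using h
  · simp only [Term.eval, Term.eval_sigma, sigma_atDepth _ (hv 0)]
    exact ite_one_zero_le_ite_one_zero (by omega)

theorem sigma_neg {k : ℕ} (hk : k ≤ n) (x : A) :
    sigma n k ∼x = ∼(sigma n (n + 1 - k) x) := by
  have h := hV.eval_eq_eval (s := .sigma n k (.neg (.var 0)))
    (t := .neg (.sigma n (n + 1 - k) (.var 0))) (fun v hv => ?_) fun _ => x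
  · simpa only [Term.eval, Term.eval_sigma] using h
  · simp only [Term.eval, Term.eval_sigma, neg_atDepth (hv 0), sigma_atDepth _ (hv 0),
      sigma_atDepth _ (Nat.sub_le n (v 0)), neg_ite_one_zero]
    exact if_congr (by have := hv 0; omega) rfl rfl

theorem sigma_one_eq_one {k : ℕ} (hk : 0 < k) : sigma n k (one : A) = one := by
  have h := hV.eval_eq_eval (s := .sigma n k .one) (t := .one) (fun v _ => ?_) fun _ => one
  · simpa only [Term.eval, Term.eval_sigma] using h
  · simp only [Term.eval, Term.eval_sigma]
    rw [← atDepth_zero (n := n), sigma_atDepth _ (Nat.zero_le n), if_pos hk, atDepth_zero]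

theorem sigma_one_le (x : A) : Le (sigma n 1 x) x := by
  have h := hV.eval_le_eval (s := .sigma n 1 (.var 0)) (t := .var 0) (fun v hv => ?_) fun _ => x
  · simpa only [Term.eval, Term.eval_sigma] using h
  · simp only [Term.eval, Term.eval_sigma, sigma_atDepth _ (hv 0)]
    split_ifs with h0
    · rw [Nat.lt_one_iff.1 h0, atDepth_zero]
      exact le_one _
    · exact zero_le' _

theorem sigma_zero_eq_zero (x : A) : sigma n 0 x = zero := by
  have h := hV.eval_eq_eval (s := .sigma n 0 (.var 0)) (t := .neg .one) (fun v hv => ?_) fun _ => x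
  · simpa only [Term.eval, Term.eval_sigma, zero] using h
  · simp only [Term.eval, Term.eval_sigma, sigma_atDepth _ (hv 0), Nat.not_lt_zero, if_false]
    rfl

theorem sigma_succ_eq_one (x : A) : sigma n (n + 1) x = one := by
  have h := hV.eval_eq_eval (s := .sigma n (n + 1) (.var 0)) (t := .one) (fun v hv => ?_) fun _ => x
  · simpa only [Term.eval, Term.eval_sigma] using h
  · simp only [Term.eval, Term.eval_sigma, sigma_atDepth _ (hv 0),
      if_pos (Nat.lt_succ_of_le (hv 0))]

theorem sigma_imp_le {i j k : ℕ} (hijk : i + k ≤ j + 1) (x y : A) :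
    Le (sigma n k (x ⇝ y)) (sigma n i x ⇝ sigma n j y) := by
  have h := hV.eval_le_eval (s := .sigma n k (.imp (.var 0) (.var 1)))
    (t := .imp (.sigma n i (.var 0)) (.sigma n j (.var 1))) (fun v hv => ?_)
    fun | 0 => x | _ => y
  · simpa only [Term.eval, Term.eval_sigma] using h
  · simp only [Term.eval, Term.eval_sigma, atDepth_imp (hv 0) (hv 1), sigma_atDepth _ (hv 0),
      sigma_atDepth _ (hv 1), sigma_atDepth k (show v 1 - v 0 ≤ n by have := hv 1; omega),
      ite_one_zero_imp_ite_one_zero]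
    exact ite_one_zero_le_ite_one_zero (by omega)

theorem le_sigma_imp {a b k : ℕ} (hab : b + 1 ≤ a + k) (hk : 0 < k) (x y : A) :
    Le ∼(sigma n a x) (sigma n (b + 1) y ⇝ sigma n k (x ⇝ y)) := by
  have h := hV.eval_le_eval (s := .neg (.sigma n a (.var 0)))
    (t := .imp (.sigma n (b + 1) (.var 1)) (.sigma n k (.imp (.var 0) (.var 1))))
    (fun v hv => ?_) fun | 0 => x | _ => y
  · simpa only [Term.eval, Term.eval_sigma] using h
  · simp only [Term.eval, Term.eval_sigma, atDepth_imp (hv 0) (hv 1), sigma_atDepth _ (hv 0),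
      sigma_atDepth _ (hv 1), sigma_atDepth k (show v 1 - v 0 ≤ n by have := hv 1; omega),
      ite_one_zero_imp_ite_one_zero, neg_ite_one_zero]
    exact ite_one_zero_le_ite_one_zero (by omega)

end IsValued

/-! ### Stone duality -/

section StoneDuality

variable {B : Type*} [BooleanAlgebra B]

theorem IsPt.not_bot {p : B → Prop} (hp : IsPt p) : ¬p ⊥ := by
  rw [← compl_top, hp.compl, not_not]
  exact hp.top

theorem IsPt.sup {p : B → Prop} (hp : IsPt p) (a b : B) : p (a ⊔ b) ↔ p a ∨ p b := by
  rw [← compl_compl (a ⊔ b), compl_sup, hp.compl, hp.inf, hp.compl, hp.compl]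
  tauto

/-- The prime filter of a Boolean homomorphism into the truth values. -/
def IsPt.toStone {p : B → Prop} (hp : IsPt p) : StoneSpace B :=
  ⟨(IsPFilter.of_def ⟨⊤, hp.top⟩
      (fun x hx y hy => ⟨x ⊓ y, (hp.inf x y).2 ⟨hx, hy⟩, inf_le_left, inf_le_right⟩)
      (fun h hx => hp.mono h hx) : IsPFilter {b | p b}).toPFilter,
    ⟨fun _ _ h hy hx => hy (hp.mono h hx), ⟨⊥, hp.not_bot⟩, fun x hx y hy =>
      ⟨x ⊔ y, fun h => ((hp.sup x y).1 h).elim hx hy, le_sup_left, le_sup_right⟩⟩⟩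

theorem StoneSpace.isPt (U : StoneSpace B) : IsPt (· ∈ U.1) where
  inf a b := ⟨fun h => ⟨PFilter.mem_of_le inf_le_left h, PFilter.mem_of_le inf_le_right h⟩,
    fun h => PFilter.inf_mem h.1 h.2⟩
  compl a := by
    have hU := U.2.compl_ideal
    constructor
    · intro h h'
      obtain ⟨z, hz⟩ := hU.2
      exact hz (PFilter.mem_of_le (inf_compl_eq_bot.le.trans bot_le) (PFilter.inf_mem h' h))
    · intro h
      by_contra hc
      obtain ⟨z, hz, h1, h2⟩ := hU.3 a h aᶜ hc
      exact hz (PFilter.mem_of_le (sup_compl_eq_top.ge.trans (sup_le h1 h2)) PFilter.top_mem)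
  top := PFilter.top_mem

namespace StoneSpace

theorem inf_mem_iff (U : StoneSpace B) {a b : B} : a ⊓ b ∈ U.1 ↔ a ∈ U.1 ∧ b ∈ U.1 :=
  U.isPt.inf a b

theorem compl_mem_iff (U : StoneSpace B) {a : B} : aᶜ ∈ U.1 ↔ a ∉ U.1 :=
  U.isPt.compl a

theorem sup_mem_iff (U : StoneSpace B) {a b : B} : a ⊔ b ∈ U.1 ↔ a ∈ U.1 ∨ b ∈ U.1 :=
  U.isPt.sup a b

theorem himp_mem_iff (U : StoneSpace B) {a b : B} : a ⇨ b ∈ U.1 ↔ (a ∈ U.1 → b ∈ U.1) :=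
  U.isPt.himp a b

theorem ext {U V : StoneSpace B} (h : ∀ b, b ∈ U.1 → b ∈ V.1) : U = V := by
  refine Subtype.ext (le_antisymm h fun b hb => ?_)
  by_contra hc
  exact V.compl_mem_iff.1 (h _ (U.compl_mem_iff.2 hc)) hb

theorem exists_le_of_notMem {F : PFilter B} {b : B} (hb : b ∉ F) :
    ∃ U : StoneSpace B, F ≤ U.1 ∧ b ∉ U.1 := by
  have hd : Disjoint (F : Set B) (Ideal.principal b) :=
    Set.disjoint_left.2 fun x hx hx' => hb (PFilter.mem_of_le (Ideal.mem_principal.1 hx') hx)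
  obtain ⟨J, hJ, hbJ, hFJ⟩ := DistribLattice.prime_ideal_of_disjoint_filter_ideal hd
  exact ⟨⟨hJ.toPrimePair.F, hJ.toPrimePair.F_isPrime⟩, fun a ha => Set.disjoint_left.1 hFJ ha,
    fun h => h (hbJ (Ideal.mem_principal.2 le_rfl))⟩

end StoneSpace

theorem mem_delta {F : PFilter B} {U : StoneSpace B} : U ∈ delta F ↔ F ≤ U.1 :=
  Set.mem_iInter₂

theorem mem_iff_forall_mem_delta {F : PFilter B} {b : B} : b ∈ F ↔ ∀ U ∈ delta F, b ∈ U.1 := by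
  refine ⟨fun h U hU => mem_delta.1 hU h, fun h => ?_⟩
  by_contra hb
  obtain ⟨U, hFU, hbU⟩ := StoneSpace.exists_le_of_notMem hb
  exact hbU (h U (mem_delta.2 hFU))

theorem le_iff_forall_stoneSpace {a b : B} : a ≤ b ↔ ∀ U : StoneSpace B, a ∈ U.1 → b ∈ U.1 := by
  refine ⟨fun h U => PFilter.mem_of_le h, fun h => ?_⟩
  by_contra hab
  obtain ⟨U, haU, hbU⟩ := StoneSpace.exists_le_of_notMem (F := PFilter.principal a) hab
  exact hbU (h U (haU (PFilter.mem_principal.2 le_rfl)))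

theorem eq_iff_forall_stoneSpace {a b : B} : a = b ↔ ∀ U : StoneSpace B, a ∈ U.1 ↔ b ∈ U.1 := by
  simp only [le_antisymm_iff, le_iff_forall_stoneSpace, iff_iff_implies_and_implies, forall_and]

theorem isClopen_stoneSet (a : B) : IsClopen (stoneSet a : Set (StoneSpace B)) :=
  ⟨isClosed_stoneSet a, TopologicalSpace.isOpen_generateFrom_of_mem ⟨a, rfl⟩⟩

theorem isTopologicalBasis_stoneSet :
    TopologicalSpace.IsTopologicalBasis (Set.range (stoneSet (B := B))) := by
  have h := TopologicalSpace.isTopologicalBasis_of_subbasis_of_inter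
    (r := Set.range (stoneSet (B := B))) rfl ?_
  · rwa [Set.insert_eq_of_mem] at h
    exact ⟨⊤, Set.eq_univ_of_forall fun U => U.isPt.top⟩
  · rintro _ ⟨a, rfl⟩ _ ⟨b, rfl⟩
    exact ⟨a ⊓ b, Set.ext fun U => U.inf_mem_iff⟩

theorem isPt_stoneSet_mem (𝓤 : Ultrafilter (StoneSpace B)) : IsPt fun b : B => stoneSet b ∈ 𝓤 where
  inf a b := by
    have h : stoneSet (a ⊓ b) = stoneSet a ∩ stoneSet b := Set.ext fun U => U.inf_mem_iff
    rw [h]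
    exact Filter.inter_mem_iff
  compl a := by
    have h : stoneSet aᶜ = (stoneSet a)ᶜ := Set.ext fun U => U.compl_mem_iff
    rw [h, Ultrafilter.compl_mem_iff_notMem]
  top := Filter.mem_of_superset Filter.univ_mem fun U _ => U.isPt.top

instance : CompactSpace (StoneSpace B) := by
  -- The limit of an ultrafilter `𝓤` is the prime filter of the `b` with `s(b)` in `𝓤`.
  refine ⟨isCompact_iff_ultrafilter_le_nhds.2 fun 𝓤 _ =>
    ⟨(isPt_stoneSet_mem 𝓤).toStone, trivial, ?_⟩⟩
  rw [TopologicalSpace.nhds_generateFrom]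
  refine le_iInf₂ ?_
  rintro _ ⟨h, ⟨b, rfl⟩⟩
  exact Filter.le_principal_iff.2 h

instance : TotallySeparatedSpace (StoneSpace B) := by
  refine totallySeparatedSpace_iff_exists_isClopen.2 fun U V hUV => ?_
  obtain ⟨b, hbU, hbV⟩ : ∃ b, b ∈ U.1 ∧ b ∉ V.1 := by
    by_contra! h
    exact hUV (StoneSpace.ext h)
  exact ⟨stoneSet b, isClopen_stoneSet b, hbU, hbV⟩

theorem exists_stoneSet_eq {C : Set (StoneSpace B)} (hC : IsClopen C) : ∃ b, stoneSet b = C := by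
  obtain ⟨b, hCb, hbC⟩ : ∃ b, C ⊆ stoneSet b ∧ stoneSet b ⊆ C := by
    refine hC.isClosed.isCompact.induction_on (p := fun t => ∃ b, t ⊆ stoneSet b ∧ stoneSet b ⊆ C)
      ?_ ?_ ?_ ?_
    · exact ⟨⊥, Set.empty_subset _, fun U hU => absurd hU U.isPt.not_bot⟩
    · rintro s t hst ⟨b, htb, hbC⟩
      exact ⟨b, hst.trans htb, hbC⟩
    · rintro s t ⟨b, hsb, hbC⟩ ⟨c, htc, hcC⟩
      have hbc : stoneSet (b ⊔ c) = stoneSet b ∪ stoneSet c := Set.ext fun U => U.sup_mem_iff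
      exact ⟨b ⊔ c, hbc ▸ Set.union_subset_union hsb htc, hbc ▸ Set.union_subset hbC hcC⟩
    · intro U hU
      obtain ⟨_, ⟨b, rfl⟩, hbU, hbC⟩ :=
        isTopologicalBasis_stoneSet.exists_subset_of_mem_open hU hC.isOpen
      exact ⟨stoneSet b, mem_nhdsWithin_of_mem_nhds ((isClopen_stoneSet b).isOpen.mem_nhds hbU), b,
        Set.Subset.rfl, hbC⟩
  exact ⟨b, hbC.antisymm hCb⟩

theorem delta_le_delta_iff {F G : PFilter B} : delta F ≤ delta G ↔ G ≤ F :=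
  ⟨fun h _ hb => mem_iff_forall_mem_delta.2 fun _ hU => mem_delta.1 (h hU) hb,
    fun h _ hU => mem_delta.2 (h.trans (mem_delta.1 hU))⟩

theorem delta_injective : Function.Injective (delta (B := B)) := fun _ _ h =>
  le_antisymm (delta_le_delta_iff.1 h.ge) (delta_le_delta_iff.1 h.le)

theorem delta_surjective : Function.Surjective (delta (B := B)) := fun C => by
  have hF : IsPFilter {b : B | (C : Set (StoneSpace B)) ⊆ stoneSet b} :=
    IsPFilter.of_def ⟨⊤, fun U _ => U.isPt.top⟩
      (fun x hx y hy => ⟨x ⊓ y, fun U hU => U.inf_mem_iff.2 ⟨hx hU, hy hU⟩, inf_le_left,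
        inf_le_right⟩)
      (fun h hx U hU => PFilter.mem_of_le h (hx hU))
  refine ⟨hF.toPFilter, TopologicalSpace.Closeds.ext (Set.Subset.antisymm (fun U hU => ?_)
    fun U hU => mem_delta.2 fun b hb => hb hU)⟩
  by_contra hc
  obtain ⟨_, ⟨b, rfl⟩, hbU, hbC⟩ :=
    isTopologicalBasis_stoneSet.exists_subset_of_mem_open hc C.isClosed.isOpen_compl
  have hb : bᶜ ∈ hF.toPFilter := fun V hV => V.compl_mem_iff.2 fun h => hbC h hV
  exact U.compl_mem_iff.1 (mem_delta.1 hU hb) hbU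

theorem delta_eq_inf_iff {F G H : PFilter B} :
    delta H = delta F ⊓ delta G ↔ IsLUB {F, G} H := by
  have le_iff (K : PFilter B) :
      delta K ≤ delta F ⊓ delta G ↔ K ∈ upperBounds {F, G} := by
    rw [le_inf_iff, delta_le_delta_iff, delta_le_delta_iff, upperBounds_insert,
      upperBounds_singleton]
    rfl
  refine ⟨fun h => isLUB_iff_le_iff.2 fun K => ?_,
    fun h => eq_of_forall_le_iff (delta_surjective.forall.2 fun K => ?_)⟩
  · rw [← delta_le_delta_iff, h, le_iff]
  · rw [le_iff, delta_le_delta_iff, isLUB_le_iff h]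

theorem exists_orderIso_of_homeomorph {B' : Type*} [BooleanAlgebra B']
    (θ : StoneSpace B ≃ₜ StoneSpace B') :
    ∃ φ : B ≃o B', ∀ b U, φ b ∈ (θ U).1 ↔ b ∈ U.1 := by
  have preimage_stoneSet (b : B) : ∃ b' : B', stoneSet b' = θ.symm ⁻¹' stoneSet b :=
    exists_stoneSet_eq ((isClopen_stoneSet b).preimage θ.symm.continuous)
  choose f hf using preimage_stoneSet
  have mem_iff (b : B) (U : StoneSpace B) : f b ∈ (θ U).1 ↔ b ∈ U.1 := by
    change θ U ∈ stoneSet (f b) ↔ U ∈ stoneSet b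
    rw [hf, Set.mem_preimage, θ.symm_apply_apply]
  have le_iff (a b : B) : f a ≤ f b ↔ a ≤ b := by
    simp only [le_iff_forall_stoneSpace, θ.surjective.forall, mem_iff]
  have surjective : Function.Surjective f := fun b' => by
    obtain ⟨b, hb⟩ := exists_stoneSet_eq ((isClopen_stoneSet b').preimage θ.continuous)
    refine ⟨b, eq_iff_forall_stoneSpace.2 (θ.surjective.forall.2 fun U => ?_)⟩
    rw [mem_iff]
    exact Set.ext_iff.1 hb U
  exact ⟨RelIso.ofSurjective (OrderEmbedding.ofMapLEIff f le_iff) surjective, mem_iff⟩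

theorem bPairIso_of_spaceIso {n : ℕ} {B' : Type*} [BooleanAlgebra B'] {h : Divs n → PFilter B}
    {h' : Divs n → PFilter B'} (hs : SpaceIso (fun d => delta (h d)) fun d => delta (h' d)) :
    BPairIso h h' := by
  obtain ⟨θ, hθ⟩ := hs
  obtain ⟨φ, hφ⟩ := exists_orderIso_of_homeomorph θ
  have mem_iff (d : Divs n) (U : StoneSpace B) : θ U ∈ delta (h' d) ↔ U ∈ delta (h d) :=
    Set.ext_iff.1 (hθ d) U
  refine ⟨φ, fun d => Set.ext fun b => ?_⟩
  change φ b ∈ h' d ↔ b ∈ h d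
  rw [mem_iff_forall_mem_delta (F := h' d), mem_iff_forall_mem_delta (F := h d)]
  simp only [θ.surjective.forall, mem_iff, hφ]

end StoneDuality

/-! ### Evaluation of monotone functions at the points of the Stone space -/

section Evaluation

instance (n : ℕ) : Finite (Idx n) :=
  ((Set.finite_Icc 1 n).subset fun _ hi => hi).to_subtype

theorem dvd_iff_forall_block {m d v : ℕ} (hm : 0 < m) (hv : v ≤ d * m) :
    m ∣ v ↔ ∀ q : Idx d, v < q.1 * m → v ≤ (q.1 - 1) * m := by
  constructor
  · rintro ⟨c, rfl⟩ q hq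
    rw [mul_comm] at hq ⊢
    exact Nat.mul_le_mul_right m (Nat.le_pred_of_lt (lt_of_mul_lt_mul_right hq (Nat.zero_le m)))
  · intro h
    rcases hv.eq_or_lt with rfl | hlt
    · exact dvd_mul_left m d
    · have hle : v ≤ v / m * m := h ⟨v / m + 1, Nat.succ_pos _, (Nat.div_lt_iff_lt_mul hm).2 hlt⟩
        ((Nat.div_lt_iff_lt_mul hm).1 (Nat.lt_succ_self _))
      exact Dvd.intro_left _ ((Nat.div_mul_le_self v m).antisymm hle)

namespace StoneSpace

variable {n : ℕ} {B : Type*} [BooleanAlgebra B] (U V : StoneSpace B)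

/-- The threshold of `f` at the prime filter `U`: `f i ∈ U` if and only if `U.cut f < i`. -/
noncomputable def cut (f : Pow n B) : ℕ := (U.isPt.exists_cut f).choose

theorem isCut_cut (f : Pow n B) : IsCut (· ∈ U.1) f (U.cut f) := (U.isPt.exists_cut f).choose_spec

theorem cut_le (f : Pow n B) : U.cut f ≤ n := (U.isCut_cut f).1

theorem mem_iff_cut_lt {f : Pow n B} {i : Idx n} : f i ∈ U.1 ↔ U.cut f < i.1 :=
  (U.isCut_cut f).2 i

variable {U} in
theorem cut_eq {f : Pow n B} {v : ℕ} (h : IsCut (· ∈ U.1) f v) : U.cut f = v :=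
  (U.isCut_cut f).unique h

variable {U V} in
theorem cut_eq_cut_iff {f g : Pow n B} : U.cut f = V.cut g ↔ ∀ i, f i ∈ U.1 ↔ g i ∈ V.1 :=
  ⟨fun h i => by rw [mem_iff_cut_lt, mem_iff_cut_lt, h],
    fun h => cut_eq ⟨V.cut_le g, fun i => (h i).trans V.mem_iff_cut_lt⟩⟩

variable [NeZero n]

/-- The evaluation `B^{[n]} → L_{n+1}` at a point of the Stone space. -/
noncomputable def eval : Hom (Pow n B) unitInterval where
  toFun f := atDepth n (U.cut f)
  map_imp f g := by
    rw [atDepth_imp (U.cut_le f) (U.cut_le g)]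
    exact congrArg _ (cut_eq (U.isPt.cut_imp (U.isCut_cut f) (U.isCut_cut g)))
  map_neg f := by
    rw [neg_atDepth (U.cut_le f)]
    exact congrArg _ (cut_eq (U.isPt.cut_neg (U.isCut_cut f)))
  map_one := by
    rw [← atDepth_zero (n := n)]
    exact congrArg _ (cut_eq U.isPt.cut_one)

variable {U V} in
theorem eval_eq_eval_iff {f g : Pow n B} :
    U.eval.toFun f = V.eval.toFun g ↔ ∀ i, f i ∈ U.1 ↔ g i ∈ V.1 :=
  (atDepth_inj (U.cut_le f) (V.cut_le g)).trans cut_eq_cut_iff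

theorem eval_mem_Luk (f : Pow n B) : U.eval.toFun f ∈ Luk n := atDepth_mem_Luk n _

theorem eval_mem_Luk_iff {f : Pow n B} {d : Divs n} :
    U.eval.toFun f ∈ Luk d.1 ↔ ∀ q, xi d q f ∈ U.1 := by
  refine (atDepth_mem_Luk_iff d (U.cut_le f)).trans
    ((dvd_iff_forall_block d.div_pos ((U.cut_le f).trans_eq d.mul_div.symm)).trans
      (forall_congr' fun q => ?_))
  rw [xi, himp_mem_iff, mem_iff_cut_lt, mem_iff_cut_lt]
  exact imp_congr Iff.rfl Nat.lt_succ_iff.symm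

theorem eventually_eval_eq (f : Pow n B) :
    ∀ᶠ V : StoneSpace B in nhds U, V.eval.toFun f = U.eval.toFun f := by
  have mem_iff : ∀ᶠ V : StoneSpace B in nhds U, ∀ i, f i ∈ V.1 ↔ f i ∈ U.1 := by
    refine Filter.eventually_all.2 fun i => ?_
    by_cases hi : f i ∈ U.1
    · filter_upwards [(isClopen_stoneSet (f i)).isOpen.mem_nhds hi] with V hV
      exact iff_of_true hV hi
    · filter_upwards [(isClopen_stoneSet (f i)).compl.isOpen.mem_nhds hi] with V hV
      exact iff_of_false hV hi
  exact mem_iff.mono fun V hV => eval_eq_eval_iff.2 hV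

theorem isLocallyConstant_eval (f : Pow n B) :
    IsLocallyConstant fun U : StoneSpace B => U.eval.toFun f :=
  (IsLocallyConstant.iff_eventually_eq _).2 fun U => U.eventually_eval_eq f

theorem isClopen_setOf_eval_eq (f g : Pow n B) :
    IsClopen {U : StoneSpace B | U.eval.toFun f = U.eval.toFun g} := by
  have h := (isLocallyConstant_eval f).prodMk (isLocallyConstant_eval g)
  exact ⟨⟨h {p | p.1 ≠ p.2}⟩, h {p | p.1 = p.2}⟩

end StoneSpace

variable {n : ℕ} {B : Type*} [BooleanAlgebra B]

theorem pow_eq_iff_forall_eval [NeZero n] {f g : Pow n B} :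
    f = g ↔ ∀ U : StoneSpace B, U.eval.toFun f = U.eval.toFun g := by
  simp only [StoneSpace.eval_eq_eval_iff]
  rw [forall_comm, OrderHom.ext_iff, funext_iff]
  exact forall_congr' fun i => eq_iff_forall_stoneSpace

end Evaluation

/-! ### The isomorphism between `M(B,h)` and the algebra of continuous functions -/

section Tilde

variable {n : ℕ} [NeZero n] {B : Type*} [BooleanAlgebra B] {h : Divs n → PFilter B}

theorem IsBPair.isValuedBooleanSpace (hB : IsBPair n B h) :
    IsValuedBooleanSpace n (StoneSpace B) fun d => delta (h d) where
  compact := inferInstance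
  hausdorff := inferInstance
  totallyDisconnected := inferInstance
  map_gcd d e := delta_eq_inf_iff.2 (hB.map_gcd d e)
  map_top := by
    refine TopologicalSpace.Closeds.ext (Set.eq_univ_of_forall fun U => mem_delta.2 fun b hb => ?_)
    have hb : b = ⊤ := hB.map_top.subset hb
    exact hb ▸ U.isPt.top

theorem isTilde_eval (g : Pow n B) : IsTilde g fun U => U.eval.toFun g := by
  intro U
  have hcut := U.cut_le g
  have coe_eval : (U.eval.toFun g : ℝ) = ((n - U.cut g : ℕ) : ℝ) / n := coe_atDepth n _
  have hn : (n : ℝ) ≠ 0 := NeZero.ne _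
  refine ⟨fun i hi h => ?_, fun k i j _ _ hi hj h => ?_, fun i hi h => ?_⟩
  · have := U.mem_iff_cut_lt.1 h
    rw [coe_eval, show U.cut g = 0 by omega, Nat.sub_zero, div_self hn]
  · have := U.mem_iff_cut_lt.1 h.1
    have := U.mem_iff_cut_lt.not.1 h.2
    rw [coe_eval, show n - U.cut g = k by omega]
  · have := U.mem_iff_cut_lt.not.1 h
    rw [coe_eval, show n - U.cut g = 0 by omega, Nat.cast_zero, zero_div]

theorem eval_mem_Cfun_iff {g : Pow n B} :
    (fun U => U.eval.toFun g) ∈ (Cfun n (StoneSpace B) fun d => delta (h d)).carrier ↔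
      g ∈ (M n B h).carrier := by
  constructor
  · intro hg d q
    exact mem_iff_forall_mem_delta.2 fun U hU => U.eval_mem_Luk_iff.1 (hg.2.2 d U hU) q
  · intro hg
    exact ⟨(StoneSpace.isLocallyConstant_eval g).continuous, fun U => U.eval_mem_Luk g,
      fun d U hU => U.eval_mem_Luk_iff.2 fun q => mem_delta.1 hU (hg d q)⟩

theorem isClopen_preimage_of_finite {X Y : Type*} [TopologicalSpace X] [TopologicalSpace Y]
    [T1Space Y] {f : X → Y} (hf : Continuous f) {F : Set Y} (hF : F.Finite) (hfF : ∀ x, f x ∈ F)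
    (S : Set Y) : IsClopen (f ⁻¹' S) := by
  have isClosed_preimage (S : Set Y) : IsClosed (f ⁻¹' S) := by
    have h : f ⁻¹' S = f ⁻¹' (S ∩ F) := Set.ext fun x => (and_iff_left (hfF x)).symm
    rw [h]
    exact (hF.inter_of_right S).isClosed.preimage hf
  exact ⟨isClosed_preimage S, isClosed_compl_iff.1 (isClosed_preimage Sᶜ)⟩

theorem exists_eval_eq {f : StoneSpace B → unitInterval} (hf : Continuous f)
    (hfn : ∀ U, f U ∈ Luk n) : ∃ g : Pow n B, ∀ U, U.eval.toFun g = f U := by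
  have exists_level (i : Idx n) : ∃ b : B, stoneSet b = f ⁻¹' (atDepth n '' Set.Iio i.1) :=
    exists_stoneSet_eq (isClopen_preimage_of_finite hf (finite_Luk n) hfn _)
  choose g hg using exists_level
  have mem_iff (U : StoneSpace B) (i : Idx n) : g i ∈ U.1 ↔ ∃ v < i.1, atDepth n v = f U :=
    Set.ext_iff.1 (hg i) U
  have monotone : Monotone g := fun i j hij => le_iff_forall_stoneSpace.2 fun U => by
    rw [mem_iff, mem_iff]
    exact fun ⟨v, hv, e⟩ => ⟨v, hv.trans_le hij, e⟩
  refine ⟨⟨g, monotone⟩, fun U => ?_⟩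
  obtain ⟨v, hv, e⟩ := exists_eq_atDepth (hfn U)
  have isCut : IsCut (· ∈ U.1) (⟨g, monotone⟩ : Pow n B) v := by
    refine ⟨hv, fun i => (mem_iff U i).trans ⟨?_, fun h => ⟨v, h, e.symm⟩⟩⟩
    rintro ⟨w, hw, e'⟩
    rwa [(atDepth_inj hv (hw.le.trans i.2.2)).1 (e.symm.trans e'.symm)]
  exact (congrArg (atDepth n) (StoneSpace.cut_eq isCut)).trans e.symm

/-- The isomorphism `Ψ : g ↦ g̃`; the value of `g̃` at `U` is the evaluation of `g` at `U`. -/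
noncomputable def tildeIso (h : Divs n → PFilter B) :
    Iso (M n B h).Elem (Cfun n (StoneSpace B) fun d => delta (h d)).Elem :=
  Iso.ofBijective
    { toFun := fun g => ⟨fun U => U.eval.toFun g.1, eval_mem_Cfun_iff.2 g.2⟩
      map_imp := fun _ _ => Subtype.ext (funext fun U => U.eval.map_imp _ _)
      map_neg := fun _ => Subtype.ext (funext fun U => U.eval.map_neg _)
      map_one := Subtype.ext (funext fun U => U.eval.map_one) }
    ⟨fun _ _ e => Subtype.ext (pow_eq_iff_forall_eval.2 (congrFun (congrArg Subtype.val e))),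
      fun f => by
        obtain ⟨g, hg⟩ := exists_eval_eq f.2.1 f.2.2.1
        have hg : (fun U => U.eval.toFun g) = f.1 := funext hg
        exact ⟨⟨g, eval_mem_Cfun_iff.1 (hg ▸ f.2)⟩, Subtype.ext hg⟩⟩

end Tilde

/-! ### Homomorphisms into `L_{n+1}` and points of the Stone space -/

namespace Hom

variable {A : Type*} [WajsbergAlgebra A] (g : Hom A unitInterval)

theorem map_eq_zero_or_one (b : BooleanPart A) : g.toFun b.1 = zero ∨ g.toFun b.1 = one :=
  eq_zero_or_one_of_odot_self (by rw [← g.map_odot, b.2])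

theorem isPt : IsPt fun b : BooleanPart A => g.toFun b.1 = one where
  inf a b := by
    change g.toFun (wedge a.1 b.1) = one ↔ _
    rw [g.map_wedge]
    refine ⟨fun h => ?_, fun ⟨ha, hb⟩ => ?_⟩
    · exact ⟨one_le (h ▸ wedge_le_left _ _), one_le (h ▸ wedge_le_right _ _)⟩
    · exact one_le (le_wedge (ha ▸ le_rfl' _) (hb ▸ le_rfl' _))
  compl a := by
    change g.toFun ∼a.1 = one ↔ _
    rw [g.map_neg]
    rcases g.map_eq_zero_or_one a with h | h <;> rw [h]
    · exact iff_of_true (neg_neg' one) zero_ne_one_unitInterval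
    · exact iff_of_false zero_ne_one_unitInterval (not_not_intro rfl)
  top := g.map_one

/-- The restriction of a homomorphism `A → [0,1]` to `B(A)`, as a point of the Stone space. -/
def toStone : StoneSpace (BooleanPart A) := g.isPt.toStone

theorem mem_toStone {g : Hom A unitInterval} {b : BooleanPart A} :
    b ∈ g.toStone.1 ↔ g.toFun b.1 = one := Iff.rfl

end Hom

namespace IsValued

variable {n : ℕ} [NeZero n] {A : Type*} [WajsbergAlgebra A] (hV : IsValued n A)

/-- `σ_i(x)` as an element of `B(A)`. -/
def sigmaB (i : ℕ) (x : A) : BooleanPart A := ⟨sigma n i x, hV.sigma_odot_self i x⟩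

/-- `(σ_1(x), …, σ_n(x))` as an element of `B(A)^{[n]}`. -/
def sigmaFun (x : A) : Pow n (BooleanPart A) :=
  ⟨fun i => hV.sigmaB i.1 x, fun _ _ h => hV.sigma_le_sigma h x⟩

theorem sigmaB_mem_iff (U : StoneSpace (BooleanPart A)) (x : A) {i : ℕ} (hi : i ≤ n + 1) :
    hV.sigmaB i x ∈ U.1 ↔ U.cut (hV.sigmaFun x) < i := by
  obtain rfl | rfl | ⟨hi₁, hi₂⟩ : i = 0 ∨ i = n + 1 ∨ 1 ≤ i ∧ i ≤ n := by omega
  · rw [show hV.sigmaB 0 x = ⊥ from Subtype.ext (hV.sigma_zero_eq_zero x)]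
    exact iff_of_false U.isPt.not_bot (Nat.not_lt_zero _)
  · rw [show hV.sigmaB (n + 1) x = ⊤ from Subtype.ext (hV.sigma_succ_eq_one x)]
    exact iff_of_true U.isPt.top (Nat.lt_succ_of_le (U.cut_le _))
  · exact U.mem_iff_cut_lt (f := hV.sigmaFun x) (i := ⟨i, hi₁, hi₂⟩)

theorem cut_sigmaFun_imp (U : StoneSpace (BooleanPart A)) (x y : A) :
    U.cut (hV.sigmaFun (x ⇝ y)) = U.cut (hV.sigmaFun y) - U.cut (hV.sigmaFun x) := by
  set v := U.cut (hV.sigmaFun x)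
  set w := U.cut (hV.sigmaFun y)
  have hvn : v ≤ n := U.cut_le _
  have hwn : w ≤ n := U.cut_le _
  refine StoneSpace.cut_eq ⟨(Nat.sub_le w v).trans hwn, fun ⟨k, hk, hkn⟩ => ?_⟩
  change hV.sigmaB k (x ⇝ y) ∈ U.1 ↔ w - v < k
  constructor
  · intro h
    by_contra! hkw
    have h' : hV.sigmaB (v + 1) x ⇨ hV.sigmaB (v + k) y ∈ U.1 :=
      PFilter.mem_of_le (hV.sigma_imp_le (by omega) x y) h
    rw [U.himp_mem_iff, hV.sigmaB_mem_iff U x (by omega), hV.sigmaB_mem_iff U y (by omega)] at h'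
    omega
  · intro h
    have hx : (hV.sigmaB v x)ᶜ ∈ U.1 := by
      rw [U.compl_mem_iff, hV.sigmaB_mem_iff U x (by omega)]
      exact lt_irrefl v
    have hy : hV.sigmaB (w + 1) y ∈ U.1 :=
      (hV.sigmaB_mem_iff U y (by omega)).2 (Nat.lt_succ_self w)
    have h' : (hV.sigmaB v x)ᶜ ≤ hV.sigmaB (w + 1) y ⇨ hV.sigmaB k (x ⇝ y) :=
      hV.le_sigma_imp (by omega) hk x y
    exact U.himp_mem_iff.1 (PFilter.mem_of_le h' hx) hy

/-- The map `x ↦ (σ_1(x), …, σ_n(x))` as a homomorphism from `A` to `B(A)^{[n]}`. -/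
def sigmaHom : Hom A (Pow n (BooleanPart A)) where
  toFun := hV.sigmaFun
  map_imp x y := pow_eq_iff_forall_eval.2 fun U => by
    rw [U.eval.map_imp]
    exact (congrArg (atDepth n) (hV.cut_sigmaFun_imp U x y)).trans
      (atDepth_imp (U.cut_le _) (U.cut_le _)).symm
  map_neg x := OrderHom.ext _ _ (funext fun k => Subtype.ext (hV.sigma_neg k.2.2 x))
  map_one := OrderHom.ext _ _ (funext fun k => Subtype.ext (hV.sigma_one_eq_one k.2.1))

theorem sigmaHom_injective : Function.Injective hV.sigmaHom.toFun := by
  refine hV.sigmaHom.injective_of_forall_eq_one fun x hx => one_le ?_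
  have h : sigma n 1 x = one :=
    congrArg (fun f : Pow n (BooleanPart A) => (f ⟨1, le_rfl, NeZero.pos n⟩).1) hx
  exact h ▸ hV.sigma_one_le x

/-- The homomorphism `A → L_{n+1}` given by a point of the Stone space of `B(A)`. -/
noncomputable def ptHom (U : StoneSpace (BooleanPart A)) : Hom A unitInterval :=
  U.eval.comp hV.sigmaHom

theorem ptHom_mem_Luk (U : StoneSpace (BooleanPart A)) (x : A) : (hV.ptHom U).toFun x ∈ Luk n :=
  U.eval_mem_Luk _

theorem ptHom_eq_one_iff (U : StoneSpace (BooleanPart A)) {b : BooleanPart A} :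
    (hV.ptHom U).toFun b.1 = one ↔ b ∈ U.1 := by
  have mem_of_eq_one (b : BooleanPart A) (h : (hV.ptHom U).toFun b.1 = one) : b ∈ U.1 := by
    have hσ : hV.sigmaB 1 b.1 ∈ U.1 := (StoneSpace.eval_eq_eval_iff.1
      (h.trans (U.eval (n := n)).map_one.symm) ⟨1, le_rfl, NeZero.pos n⟩).2 U.isPt.top
    exact PFilter.mem_of_le (hV.sigma_one_le b.1) hσ
  refine ⟨mem_of_eq_one b, fun hb => ?_⟩
  by_contra h
  exact U.compl_mem_iff.1 (mem_of_eq_one bᶜ (((hV.ptHom U).isPt.compl b).2 h)) hb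

theorem ptHom_toStone {g : Hom A unitInterval} (hg : ∀ x, g.toFun x ∈ Luk n) (x : A) :
    (hV.ptHom g.toStone).toFun x = g.toFun x := by
  obtain ⟨v, hv, hx⟩ := exists_eq_atDepth (hg x)
  have isCut : IsCut (· ∈ g.toStone.1) (hV.sigmaFun x) v := by
    refine ⟨hv, fun i => ?_⟩
    change g.toFun (sigma n i.1 x) = one ↔ _
    rw [g.map_sigma, hx, sigma_atDepth _ hv, ite_eq_left_iff]
    exact ⟨fun h => not_not.1 fun hvi => zero_ne_one_unitInterval (h hvi), absurd⟩
  exact (congrArg (atDepth n) (StoneSpace.cut_eq isCut)).trans hx.symm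

theorem sigmaFun_mem_M (x : A) : hV.sigmaFun x ∈ (M n (BooleanPart A) (hA n A)).carrier := by
  refine fun d q => mem_hA_iff.2 fun g hg => ?_
  have hgn (y : A) : g.toFun y ∈ Luk n :=
    (Luk_subset_Luk_iff d.pos (NeZero.pos n)).2 (Nat.dvd_of_mem_divisors d.2) (hg y)
  have hx : (hV.ptHom g.toStone).toFun x ∈ Luk d.1 := (hV.ptHom_toStone hgn x).symm ▸ hg x
  exact Hom.mem_toStone.1 (g.toStone.eval_mem_Luk_iff.1 hx q)

theorem mem_delta_hA_iff {U : StoneSpace (BooleanPart A)} {d : Divs n} :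
    U ∈ delta (hA n A d) ↔ ∀ x, (hV.ptHom U).toFun x ∈ Luk d.1 :=
  ⟨fun h x => U.eval_mem_Luk_iff.2 fun q => mem_delta.1 h (hV.sigmaFun_mem_M x d q),
    fun h => mem_delta.2 fun _ hb => (hV.ptHom_eq_one_iff U).1 (mem_hA_iff.1 hb _ h)⟩

include hV in
theorem delta_hA_gcd (d e : Divs n) :
    delta (hA n A (d.gcd e)) = delta (hA n A d) ⊓ delta (hA n A e) := by
  refine TopologicalSpace.Closeds.ext (Set.ext fun U => ?_)
  change U ∈ delta _ ↔ U ∈ delta _ ∧ U ∈ delta _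
  simp only [hV.mem_delta_hA_iff, ← forall_and]
  exact forall_congr' fun x => Set.ext_iff.1 (Luk_gcd d.pos e.pos) _

include hV in
theorem isBPair : IsBPair n (BooleanPart A) (hA n A) where
  map_top := by
    refine Set.eq_singleton_iff_unique_mem.2 ⟨PFilter.top_mem, fun b hb => ?_⟩
    refine eq_iff_forall_stoneSpace.2 fun U => iff_of_true ?_ U.isPt.top
    exact (hV.ptHom_eq_one_iff U).1 (mem_hA_iff.1 hb _ (hV.ptHom_mem_Luk U))
  map_gcd d e := delta_eq_inf_iff.1 (hV.delta_hA_gcd d e)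

end IsValued

/-! ### The isomorphism `x ↦ (σ_1(x), …, σ_n(x))` -/

section Patching

variable {A A' : Type*} [WajsbergAlgebra A] [WajsbergAlgebra A'] (g : Hom A A')

theorem Hom.map_vee_wedge_neg_of_eq_one {b : A} (hb : g.toFun b = one) (x y : A) :
    g.toFun (vee (wedge b x) (wedge ∼b y)) = g.toFun x := by
  rw [g.map_vee, g.map_wedge, g.map_wedge, g.map_neg, hb]
  exact Le.antisymm (vee_le (wedge_le_right _ _) ((wedge_le_left _ _).trans (zero_le' _)))
    (Le.trans (le_wedge (le_one _) (le_rfl' _)) (le_vee_left _ _))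

theorem Hom.map_vee_wedge_neg_of_eq_zero {b : A} (hb : g.toFun b = zero) (x y : A) :
    g.toFun (vee (wedge b x) (wedge ∼b y)) = g.toFun y := by
  rw [g.map_vee, g.map_wedge, g.map_wedge, g.map_neg, hb, zero, neg_neg']
  exact Le.antisymm (vee_le ((wedge_le_left _ _).trans (zero_le' _)) (wedge_le_right _ _))
    (Le.trans (le_wedge (le_one _) (le_rfl' _)) (le_vee_right _ _))

end Patching

namespace IsValued

variable {n : ℕ} [NeZero n] {A : Type*} [WajsbergAlgebra A] (hV : IsValued n A)

theorem exists_ptHom_eq {f : Pow n (BooleanPart A)}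
    (hf : f ∈ (M n (BooleanPart A) (hA n A)).carrier) (U : StoneSpace (BooleanPart A)) :
    ∃ a, (hV.ptHom U).toFun a = U.eval.toFun f := by
  obtain ⟨d, hd⟩ := Hom.exists_range_eq_Luk (hV.ptHom_mem_Luk U)
  have hU : U ∈ delta (hA n A d) := hV.mem_delta_hA_iff.2 fun x => hd ▸ Set.mem_range_self x
  have hfU : U.eval.toFun f ∈ Luk d.1 :=
    U.eval_mem_Luk_iff.2 fun q => mem_delta.1 hU (hf d q)
  rwa [← hd] at hfU

theorem exists_forall_mem_union_ptHom_eq {f : Pow n (BooleanPart A)} {a₁ a₂ : A}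
    {s t : Set (StoneSpace (BooleanPart A))}
    (h₁ : ∀ U ∈ s, (hV.ptHom U).toFun a₁ = U.eval.toFun f)
    (h₂ : ∀ U ∈ t, (hV.ptHom U).toFun a₂ = U.eval.toFun f) :
    ∃ a, ∀ U ∈ s ∪ t, (hV.ptHom U).toFun a = U.eval.toFun f := by
  obtain ⟨b, hb⟩ :=
    exists_stoneSet_eq (StoneSpace.isClopen_setOf_eval_eq (hV.sigmaFun a₁) f)
  have mem_iff (U : StoneSpace (BooleanPart A)) :
      b ∈ U.1 ↔ (hV.ptHom U).toFun a₁ = U.eval.toFun f := Set.ext_iff.1 hb U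
  refine ⟨vee (wedge b.1 a₁) (wedge ∼b.1 a₂), fun U hU => ?_⟩
  by_cases hbU : b ∈ U.1
  · rw [Hom.map_vee_wedge_neg_of_eq_one _ ((hV.ptHom_eq_one_iff U).2 hbU)]
    exact (mem_iff U).1 hbU
  · have hb₀ := ((hV.ptHom U).map_eq_zero_or_one b).resolve_right
      (mt (hV.ptHom_eq_one_iff U).1 hbU)
    rw [Hom.map_vee_wedge_neg_of_eq_zero _ hb₀]
    exact h₂ U (hU.resolve_left fun hs => hbU ((mem_iff U).2 (h₁ U hs)))

theorem exists_sigmaHom_eq {f : Pow n (BooleanPart A)}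
    (hf : f ∈ (M n (BooleanPart A) (hA n A)).carrier) : ∃ a, hV.sigmaHom.toFun a = f := by
  obtain ⟨a, ha⟩ : ∃ a, ∀ U ∈ Set.univ, (hV.ptHom U).toFun a = U.eval.toFun f := by
    refine isCompact_univ.induction_on
      (p := fun s => ∃ a, ∀ U ∈ s, (hV.ptHom U).toFun a = U.eval.toFun f) ?_ ?_ ?_ ?_
    · exact ⟨one, fun _ hU => hU.elim⟩
    · exact fun _ _ hst ⟨a, ha⟩ => ⟨a, fun U hU => ha U (hst hU)⟩
    · exact fun _ _ ⟨_, h₁⟩ ⟨_, h₂⟩ => hV.exists_forall_mem_union_ptHom_eq h₁ h₂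
    · intro U _
      obtain ⟨a, ha⟩ := hV.exists_ptHom_eq hf U
      refine ⟨_, mem_nhdsWithin_of_mem_nhds ?_, a, fun _ h => h⟩
      exact (StoneSpace.isClopen_setOf_eval_eq (hV.sigmaFun a) f).isOpen.mem_nhds ha
  exact ⟨a, pow_eq_iff_forall_eval.2 fun U => ha U trivial⟩

/-- The isomorphism `x ↦ (σ_1(x), …, σ_n(x))` from `A` onto `M(B(A), h_A)`. -/
noncomputable def sigmaIso : Iso A (M n (BooleanPart A) (hA n A)).Elem :=
  Iso.ofBijective
    { toFun := fun x => ⟨hV.sigmaHom.toFun x, hV.sigmaFun_mem_M x⟩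
      map_imp := fun _ _ => Subtype.ext (hV.sigmaHom.map_imp _ _)
      map_neg := fun _ => Subtype.ext (hV.sigmaHom.map_neg _)
      map_one := Subtype.ext hV.sigmaHom.map_one }
    ⟨fun _ _ h => hV.sigmaHom_injective (congrArg Subtype.val h),
      fun f => (hV.exists_sigmaHom_eq f.2).imp fun _ => Subtype.ext⟩

include hV in
theorem sigmaIso_holds : SigmaIso n A := ⟨hV.sigmaIso, fun _ _ => rfl⟩

end IsValued

/-! ### Representing spaces -/

theorem IsValuedBooleanSpace.exists_forall_mem_iff_dvd {n : ℕ} [NeZero n] {X : Type*}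
    [TopologicalSpace X] {h : Divs n → TopologicalSpace.Closeds X}
    (hX : IsValuedBooleanSpace n X h) (x : X) : ∃ m : Divs n, ∀ d, x ∈ h d ↔ m.1 ∣ d.1 := by
  have mem_gcd_iff (d e : Divs n) : x ∈ h (d.gcd e) ↔ x ∈ h d ∧ x ∈ h e := by
    rw [hX.map_gcd]
    rfl
  have top_mem : x ∈ h (Divs.top n) := hX.map_top ▸ trivial
  obtain ⟨m, hm, hmin⟩ := Set.exists_min_image {d | x ∈ h d} Subtype.val (Set.toFinite _)
    ⟨_, top_mem⟩
  refine ⟨m, fun d => ⟨fun hd => ?_, fun hmd => ?_⟩⟩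
  · have gcd_eq : m.1.gcd d.1 = m.1 :=
      (Nat.gcd_le_left _ m.pos).antisymm (hmin (m.gcd d) ((mem_gcd_iff m d).2 ⟨hm, hd⟩))
    exact Nat.gcd_eq_left_iff_dvd.1 gcd_eq
  · have gcd_eq : m.gcd d = m := Subtype.ext (Nat.gcd_eq_left hmd)
    exact ((mem_gcd_iff m d).1 (gcd_eq.symm ▸ hm)).2

theorem exists_isClopen_forall_mem_imp_mem {X ι : Type*} [TopologicalSpace X] [CompactSpace X]
    [T2Space X] [TotallyDisconnectedSpace X] [Finite ι] (C : ι → TopologicalSpace.Closeds X)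
    (x : X) : ∃ N, IsClopen N ∧ x ∈ N ∧ ∀ y ∈ N, ∀ i, y ∈ C i → x ∈ C i := by
  have isOpen : IsOpen (⋂ i ∈ {i | x ∉ C i}, (C i : Set X)ᶜ) :=
    (Set.toFinite _).isOpen_biInter fun i _ => (C i).isClosed.isOpen_compl
  obtain ⟨N, hN, hxN, hNC⟩ :=
    compact_exists_isClopen_in_isOpen isOpen (Set.mem_iInter₂.2 fun _ hi => hi)
  refine ⟨N, hN, hxN, fun y hy i hyi => ?_⟩
  by_contra hxi
  exact Set.mem_iInter₂.1 (hNC hy) i hxi hyi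

open Classical in
theorem continuous_ite_mem_of_isClopen {X Y : Type*} [TopologicalSpace X] [TopologicalSpace Y]
    {N : Set X} (hN : IsClopen N) (c d : Y) : Continuous fun x => if x ∈ N then c else d :=
  continuous_const.if (by simp [hN.frontier_eq]) continuous_const

section Evaluation

variable {n : ℕ} [NeZero n] {X : Type*} [TopologicalSpace X]
  {h : Divs n → TopologicalSpace.Closeds X} {A : Type*} [WajsbergAlgebra A]

namespace Iso

variable (φ : Iso A (Cfun n X h).Elem)

/-- For an algebra isomorphic to an algebra of functions on `X`, the evaluation of these functions
at a point of `X`. -/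
noncomputable def evalAt (x : X) : Hom A unitInterval :=
  (evalHom unitInterval x).comp ((Cfun n X h).incl.comp φ.hom)

theorem evalAt_mem_Luk (x : X) (a : A) : (φ.evalAt x).toFun a ∈ Luk n := (φ.toFun a).2.2.1 x

theorem eq_of_forall_evalAt_eq {a b : A} (hab : ∀ x, (φ.evalAt x).toFun a = (φ.evalAt x).toFun b) :
    a = b :=
  φ.toEquiv.injective (Subtype.ext (funext hab))

theorem isValued_of_Cfun (φ : Iso A (Cfun n X h).Elem) : IsValued n A :=
  isValued_of_separating fun _ _ hab =>
    φ.eq_of_forall_evalAt_eq fun x => hab (φ.evalAt x) (φ.evalAt_mem_Luk x)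

open Classical in
theorem exists_evalAt_eq_ite {N : Set X} (hN : IsClopen N) {m : Divs n}
    (hm : ∀ x ∈ N, ∀ d, x ∈ h d → m.1 ∣ d.1) {c : unitInterval} (hc : c ∈ Luk m.1) :
    ∃ a, ∀ x, (φ.evalAt x).toFun a = if x ∈ N then c else zero := by
  have ite_mem_Luk (x : X) (d : Divs n) (hd : x ∈ N → m.1 ∣ d.1) :
      (if x ∈ N then c else zero) ∈ Luk d.1 := by
    split_ifs with hx
    · exact (Luk_subset_Luk_iff m.pos d.pos).2 (hd hx) hc
    · exact neg_mem_Luk d.pos (one_mem_Luk d.pos)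
  have mem_Cfun : (fun x => if x ∈ N then c else zero) ∈ (Cfun n X h).carrier :=
    ⟨continuous_ite_mem_of_isClopen hN c zero,
      fun x => ite_mem_Luk x (Divs.top n) fun _ => Nat.dvd_of_mem_divisors m.2,
      fun d x hxd => ite_mem_Luk x d fun hx => hm x hx d hxd⟩
  obtain ⟨a, ha⟩ := φ.toEquiv.surjective ⟨_, mem_Cfun⟩
  exact ⟨a, congrFun (congrArg Subtype.val ha)⟩

/-- The map from a representing space `X` to the Stone space of `B(A)` that sends a point to the
set of the `b` with value `1` at it. -/
noncomputable def stoneMap (x : X) : StoneSpace (BooleanPart A) := (φ.evalAt x).toStone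

theorem continuous_stoneMap : Continuous φ.stoneMap := by
  refine continuous_generateFrom_iff.2 ?_
  rintro _ ⟨b, rfl⟩
  obtain ⟨hcont, hmem, -⟩ := (φ.toFun b.1).2
  exact (isClopen_preimage_of_finite hcont (finite_Luk n) hmem {one}).isOpen

theorem stoneMap_injective [TotallySeparatedSpace X] : Function.Injective φ.stoneMap := by
  classical
  intro x y hxy
  by_contra hne
  obtain ⟨N, hN, hxN, hyN⟩ := exists_isClopen_of_totally_separated hne
  let m : Divs n := ⟨1, Nat.one_mem_divisors.2 (NeZero.ne n)⟩
  obtain ⟨a, ha⟩ := φ.exists_evalAt_eq_ite hN (m := m) (fun _ _ _ _ => one_dvd _)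
    (one_mem_Luk m.pos)
  have odot_self : odot a a = a := φ.eq_of_forall_evalAt_eq fun z => by
    rw [Hom.map_odot, ha, ite_one_zero_odot_self]
  have a_mem_stoneMap (z : X) : ⟨a, odot_self⟩ ∈ (φ.stoneMap z).1 ↔ z ∈ N := by
    refine Hom.mem_toStone.trans ?_
    rw [ha, ite_eq_left_iff, imp_iff_not zero_ne_one_unitInterval, not_not]
  exact hyN ((a_mem_stoneMap y).1 (hxy ▸ (a_mem_stoneMap x).2 hxN))

theorem stoneMap_surjective [CompactSpace X] : Function.Surjective φ.stoneMap := by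
  have denseRange : DenseRange φ.stoneMap := by
    refine isTopologicalBasis_stoneSet.dense_iff.2 ?_
    rintro _ ⟨b, rfl⟩ ⟨U, hbU⟩
    by_contra hempty
    have hb : b.1 = (⊥ : BooleanPart A).1 := φ.eq_of_forall_evalAt_eq fun x => by
      refine (((φ.evalAt x).map_eq_zero_or_one b).resolve_right fun hx => ?_).trans
        (φ.evalAt x).map_zero.symm
      exact hempty ⟨φ.stoneMap x, hx, x, rfl⟩
    exact U.isPt.not_bot (Subtype.ext hb ▸ hbU)
  have isClosed_range := (isCompact_range φ.continuous_stoneMap).isClosed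
  exact Set.range_eq_univ.1 (isClosed_range.closure_eq.symm.trans denseRange.closure_eq)

theorem forall_evalAt_mem_Luk_iff (hX : IsValuedBooleanSpace n X h) {x : X} {d : Divs n} :
    (∀ a, (φ.evalAt x).toFun a ∈ Luk d.1) ↔ x ∈ h d := by
  classical
  refine ⟨fun hd => ?_, fun hx a => (φ.toFun a).2.2.2 d x hx⟩
  have := hX.compact
  have := hX.hausdorff
  have := hX.totallyDisconnected
  obtain ⟨m, hm⟩ := hX.exists_forall_mem_iff_dvd x
  obtain ⟨N, hN, hxN, hNx⟩ := exists_isClopen_forall_mem_imp_mem h x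
  have hNm (y : X) (hy : y ∈ N) (e : Divs n) (hye : y ∈ h e) : m.1 ∣ e.1 :=
    (hm e).1 (hNx y hy e hye)
  refine (hm d).2 ((Luk_subset_Luk_iff m.pos d.pos).1 fun c hc => ?_)
  obtain ⟨a, ha⟩ := φ.exists_evalAt_eq_ite hN hNm hc
  exact (ha x).trans (if_pos hxN) ▸ hd a

theorem stoneMap_mem_delta_hA_iff (hX : IsValuedBooleanSpace n X h) {x : X} {d : Divs n} :
    φ.stoneMap x ∈ delta (hA n A d) ↔ x ∈ h d := by
  have hV := φ.isValued_of_Cfun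
  rw [hV.mem_delta_hA_iff, ← φ.forall_evalAt_mem_Luk_iff hX]
  simp only [stoneMap, hV.ptHom_toStone (φ.evalAt_mem_Luk x)]

end Iso

theorem IsValuedBooleanSpace.spaceIso (hX : IsValuedBooleanSpace n X h)
    (φ : Iso A (Cfun n X h).Elem) : SpaceIso h fun d => delta (hA n A d) := by
  have := hX.compact
  have := hX.hausdorff
  have := hX.totallyDisconnected
  let θ := Equiv.ofBijective φ.stoneMap ⟨φ.stoneMap_injective, φ.stoneMap_surjective⟩
  exact ⟨Continuous.homeoOfEquivCompactToT2 (f := θ) φ.continuous_stoneMap,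
    fun d => Set.ext fun x => φ.stoneMap_mem_delta_hA_iff hX⟩

end Evaluation

/-! ### Uniqueness of the representing space -/

section SpaceIso

variable {n : ℕ} {X Y Z : Type*} [TopologicalSpace X] [TopologicalSpace Y] [TopologicalSpace Z]
  {h : Divs n → TopologicalSpace.Closeds X} {g : Divs n → TopologicalSpace.Closeds Y}
  {k : Divs n → TopologicalSpace.Closeds Z}

theorem SpaceIso.symm : SpaceIso h g → SpaceIso g h := by
  rintro ⟨φ, hφ⟩
  exact ⟨φ.symm, fun d => by
    rw [← hφ, ← Set.preimage_comp, φ.self_comp_symm, Set.preimage_id]⟩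

theorem SpaceIso.trans : SpaceIso h g → SpaceIso g k → SpaceIso h k := by
  rintro ⟨φ, hφ⟩ ⟨ψ, hψ⟩
  exact ⟨φ.trans ψ, fun d => by rw [← hφ, ← hψ]; rfl⟩

end SpaceIso

theorem Iso.isValued_of_subalg_pow {n : ℕ} [NeZero n] {B : Type*} [BooleanAlgebra B]
    {S : Subalg (Pow n B)} {A : Type*} [WajsbergAlgebra A] (φ : Iso A S.Elem) : IsValued n A :=
  isValued_of_separating fun _ _ hab => φ.toEquiv.injective <| Subtype.ext <|
    pow_eq_iff_forall_eval.2 fun U =>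
      hab (U.eval.comp (S.incl.comp φ.hom)) fun _ => U.eval_mem_Luk _

namespace IsValued

variable {n : ℕ} [NeZero n]

theorem represents {A : Type*} [WajsbergAlgebra A] (hV : IsValued n A) :
    Represents n A (StoneSpace (BooleanPart A)) fun d => delta (hA n A d) :=
  ⟨hV.isBPair.isValuedBooleanSpace, ⟨hV.sigmaIso.trans (tildeIso _)⟩⟩

theorem uniquelyRepresentable {A : Type u} [WajsbergAlgebra A] (hV : IsValued n A) :
    UniquelyRepresentable.{u, v, w} n A :=
  ⟨⟨_, _, _, hV.represents⟩,
    fun _ _ _ _ _ _ ⟨hX, ⟨φ⟩⟩ ⟨hY, ⟨ψ⟩⟩ => (hX.spaceIso φ).trans (hY.spaceIso ψ).symm,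
    fun _ _ _ ⟨hX, ⟨φ⟩⟩ => let ⟨θ, _⟩ := hX.spaceIso φ; ⟨θ⟩⟩

end IsValued

theorem IsBPair.bPairIso_hA {n : ℕ} [NeZero n] {B : Type*} [BooleanAlgebra B]
    {h : Divs n → PFilter B} (hB : IsBPair n B h) {A : Type*} [WajsbergAlgebra A]
    (φ : Iso A (Cfun n (StoneSpace B) fun d => delta (h d)).Elem) : BPairIso h (hA n A) :=
  bPairIso_of_spaceIso (hB.isValuedBooleanSpace.spaceIso φ)

end WajsbergAlgebra

theorem mainTheorem6 (n : ℕ) [NeZero n] :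
    -- for each Wajsberg algebra, the two representation statements are equivalent
    (∀ (A : Type u) [WajsbergAlgebra A],
      WajsbergAlgebra.SigmaIso n A ↔ WajsbergAlgebra.UniquelyRepresentable.{u, v, w} n A) ∧
    -- both of them hold for each `(n+1)`-valued algebra, and `⟨χ(B(A)), δ ∘ h_A⟩` represents `A`
    (∀ (A : Type u) [WajsbergAlgebra A], WajsbergAlgebra.IsValued n A →
      WajsbergAlgebra.SigmaIso n A ∧ WajsbergAlgebra.UniquelyRepresentable.{u, v, w} n A ∧
      WajsbergAlgebra.IsBPair n (WajsbergAlgebra.BooleanPart A) (WajsbergAlgebra.hA n A) ∧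
      WajsbergAlgebra.Represents n A
        (WajsbergAlgebra.StoneSpace (WajsbergAlgebra.BooleanPart A))
        (fun d => WajsbergAlgebra.delta (WajsbergAlgebra.hA n A d))) ∧
    -- a pair `⟨B, h⟩` is determined by `M(B,h)`, and so by the algebra of continuous functions
    (∀ (B : Type u) [BooleanAlgebra B] (h : WajsbergAlgebra.Divs n → PFilter B),
      WajsbergAlgebra.IsBPair n B h →
      WajsbergAlgebra.BPairIso h (WajsbergAlgebra.hA n (WajsbergAlgebra.M n B h).Elem) ∧
      ∀ (A : Type u) [WajsbergAlgebra A],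
        Nonempty (WajsbergAlgebra.Iso A (WajsbergAlgebra.Cfun n (WajsbergAlgebra.StoneSpace B)
          (fun d => WajsbergAlgebra.delta (h d))).Elem) →
        WajsbergAlgebra.BPairIso h (WajsbergAlgebra.hA n A)) ∧
    -- `δ` is an order-antiisomorphism
    (∀ (B : Type u) [BooleanAlgebra B],
      Function.Bijective (WajsbergAlgebra.delta (B := B)) ∧
      ∀ F G : PFilter B, WajsbergAlgebra.delta F ≤ WajsbergAlgebra.delta G ↔ G ≤ F) ∧
    -- the isomorphism `Ψ`
    (∀ (B : Type u) [BooleanAlgebra B] (h : WajsbergAlgebra.Divs n → PFilter B),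
      WajsbergAlgebra.IsBPair n B h →
      WajsbergAlgebra.IsValuedBooleanSpace n (WajsbergAlgebra.StoneSpace B)
        (fun d => WajsbergAlgebra.delta (h d)) ∧
      ∃ Ψ : WajsbergAlgebra.Iso (WajsbergAlgebra.M n B h).Elem
          (WajsbergAlgebra.Cfun n (WajsbergAlgebra.StoneSpace B)
            (fun d => WajsbergAlgebra.delta (h d))).Elem,
        ∀ g, WajsbergAlgebra.IsTilde g.1 (Ψ.toFun g).1) := by
  open WajsbergAlgebra in
  refine ⟨fun A _ => ⟨fun ⟨φ, _⟩ => φ.isValued_of_subalg_pow.uniquelyRepresentable,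
      fun ⟨⟨_, _, _, _, ⟨φ⟩⟩, _⟩ => φ.isValued_of_Cfun.sigmaIso_holds⟩,
    fun A _ hV => ⟨hV.sigmaIso_holds, hV.uniquelyRepresentable, hV.isBPair, hV.represents⟩,
    fun B _ h hB => ⟨hB.bPairIso_hA (tildeIso h), fun A _ ⟨φ⟩ => hB.bPairIso_hA φ⟩,
    fun B _ => ⟨⟨delta_injective, delta_surjective⟩, fun _ _ => delta_le_delta_iff⟩,
    fun B _ h hB => ⟨hB.isValuedBooleanSpace, tildeIso h, fun g => isTilde_eval g.1⟩⟩
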